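/- **Setting.** Time is $\mathbb R_{\ge 0}$ and is divided into consecutive slots; $E\ge 2$ consecutive slots form an epoch. For an epoch $e$ write $\mathrm{fs}(e),\mathrm{ls}(e)$ for its first and last slot and $\mathrm{st}(\cdot)$ for the start time of a slot or an epoch. $\mathsf{GST}$ is the global stabilization time and $\Delta$ the maximum latency; $\mathsf{GGST}$ is $\mathrm{st}(\mathrm{epoch}(\mathsf{GST})+1)$ if $\mathsf{GST}\le \mathrm{st}(\mathrm{ls}(\mathrm{epoch}(\mathsf{GST})))$, and $\mathrm{st}(\mathrm{epoch}(\mathsf{GST})+2)$ otherwise. Validators are honest or Byzantine. $\mathcal V^{v,t}$ is the (finite, growing in $t$, containing genesis) set of messages (blocks, GHOST votes, FFG votes) received by $v$ by time $t$. Honest validators gossip what they receive; a message sent by an honest validator at time $t$ reaches every honest validator by $\max(t,\mathsf{GST})+\Delta$; signatures are unforgeable. Each slot has a committee; committees of different slots of one epoch are disjoint and their union is the validator set of the epoch; from $\mathsf{GGST}$ on, honest validators agree on the committees; the validator set of epoch $0$ is the set of validators with a positive genesis balance. An honest member of the committee of slot $s$ casts, during $s$ and more than $\Delta$ before its end, exactly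 one GHOST vote, for its fork-choice output $b$, and one FFG vote $VS(b,e)\to C(b,e)$, $e=\mathrm{epoch}(s)$. Honest validators sign no other votes and commit no slashable offence. Valid blocks form a tree rooted at the genesis block (slot $0$), with slots strictly increasing from parent to child; $a\preceq b$ means that $a$ is on the chain of $b$. A checkpoint is a pair (block, epoch). $C(b,e)$ is the pair of the highest-slot block on the chain of $b$ with slot $\le \mathrm{fs}(e)$, and $e$. For checkpoints and blocks, $C\preceq b$ means $C(b,\mathrm{epoch}(C))=C$, $b\preceq C$ means $b\preceq\mathrm{block}(C)$, and $C\preceq C'$ means $C=C'$ or ($\mathrm{epoch}(C)<\mathrm{epoch}(C')$ and $C\preceq \mathrm{block}(C')$). Each block $b$ determines an effective-balance assignment, a set $U(b)$ of unrealized justified checkpoints, a set of finalized checkpoints and a set $D(b)$ of validators with slashing evidence in its chain. $GU(b)$, $GF(b)$ are the elements of highest epoch in $U(b)$ and in the finalized set. $GJ(b)$ is $GU$ of the last block of the chain of $b$ with epoch lower than $\mathrm{epoch}(b)$ (the genesis checkpoint if $\mathrm{epoch}(b)=0$). The voting source $VS(b,e)$ is $GU(b)$ if $\mathrm{epoch}(b)<e$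 and $GJ(b)$ if $\mathrm{epoch}(b)=e$. $GJ^{v,t}$, $GF^{v,t}$ are the checkpoints of highest epoch among $VS(b',\mathrm{epoch}(t))$, respectively $GF(b')$, over the non-future blocks $b'$ in $\mathcal V^{v,t}$. $|S|_C$ is the total balance of the validators in $S$ according to $\mathrm{block}(C)$ and $|\mathrm{all}|_C$ the total balance; $|\cdot|_b$ is the same according to a block $b$. "$C$ can be justified" means $C\in U(b)$ for some possible block $b$. *Fork choice.* LMD-GHOST first discards GHOST votes of validators with two votes of the same slot for different blocks, then votes of the current or later slots, then votes whose signer is not in the committee of their slot or whose slot is below that of the block voted for, and then keeps only the highest-slot votes of each validator. GHOST then starts at genesis and, among the children with slot at most the current one, repeatedly moves to one maximizing the weight of the validators voting for it or its descendants, plus the proposer boost $\frac pE|\mathrm{all}|$ if the currently boosted block (if any) descends from it; ties are arbitrary. $\text{LMD-GHOST-HFC}^{GJ}$, for validator $v$ at time $t$, is LMD-GHOST with balances from $GJ^{v,t}$, applied after removing every block $b$ except those with $b\preceq GJ^{v,t}$ and those with $\mathrm{block}(GJ^{v,t})\preceq b$ for which the view has a block $b'\succeq b$, without non-future children, with $GF^{v,t}\preceq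 b'$, $\mathrm{epoch}(b')\le\mathrm{epoch}(t)$, and $VS(b',\mathrm{epoch}(t))=GJ^{v,t}$ or $\mathrm{epoch}(VS(b',\mathrm{epoch}(t)))\ge\mathrm{epoch}(t)-2$. **Assumptions.** Let $\beta\ge0$, $\mathit{safetyDecay}\in\mathbb R$, $W\in[0,\infty]$. 1. *Fixed validator set.* From $\mathsf{GGST}$ on, validator sets only change by Byzantine validators leaving the genesis one, honest members are the same in every epoch; balances do not increase along a chain, and change only for validators slashed in that chain. 2. *$\beta$-bound.* From $\mathsf{GGST}$ on, for any range of slots and any justified checkpoint $C$, the honest members of the committees of the range have weight $|\cdot|_C$ at least $(1-\beta)$ times that of all the members. 3. *Slashing bound.* For every block $b$, $D(b)$ has total genesis balance at most $W$. 4. $\beta<\min(\tfrac16,\ \tfrac13-\mathit{safetyDecay})$. 5. *Strong FFG justification.* For all $b$ and $e\ge\mathrm{epoch}(b)$ with $\mathrm{st}(e+1)\ge\mathsf{GGST}$: suppose that for every time $t$ in epoch $e+1$ and every honest $v$, $b$ is canonical for $v$ at $t$ and, for every $b'$ in $\mathcal V^{v,t}$ with $C(b,e)\preceq b'$, the non-slashed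 (not in $D(b')$) signers of FFG votes $VS(b,e)\to C(b,e)$ sent by time $t$ have at least $\frac23$ of the total weight according to $b'$. Then for every honest $v$ there is a checkpoint $C\succeq b$ of epoch $e+1$ such that the view of $v$ at $\mathrm{st}(\mathrm{ls}(e+1))$ has a block $b'\succeq C$ with $\mathrm{epoch}(b')<e+2$ and $C(b,e)\in U(b')$, and such that for all $t'\ge\mathrm{st}(e+2)$ the honest signers of FFG votes $VS(\mathrm{block}(C),e+1)\to C$ in $\mathcal V^{v,t'}$ have $|\cdot|_C$-weight greater than $\frac{1}{1-\beta}\left(\frac23+\beta\right)$ times that of the set of all honest validators. 6. *Gasper properties.* (a) The genesis checkpoint is justified and finalized; $U$ grows along chains; for $C\in U(b)$, $C\preceq b$ and $\mathrm{epoch}(C)\le\mathrm{epoch}(b)$; finalized checkpoints are justified. (b) $GF^{v,t}\preceq GJ^{v,t}$ for honest $v$. If $\beta<\frac13-\mathit{safetyDecay}$: (c) no two different checkpoints of the same epoch can be justified; (d) if $GJ^{v,t}\preceq C$ for an honest $v$, or $D\preceq C$ for some $D$ of epoch $\mathrm{epoch}(C)-1$ that can be justified, and signers of FFG votes with target $C$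 sent by time $t$ have weight at least $\frac23|\mathrm{all}|_C$, then no other checkpoint of epoch $\mathrm{epoch}(C)$ can be justified; (e) if $\mathrm{st}(e)\ge\mathsf{GGST}$ and all honest validators of epoch $e$ send, by $\mathrm{st}(e+1)$, FFG votes with epoch-$e$ targets descending from $b$, then no epoch-$e$ checkpoint $C$ with neither $C\preceq b$ nor $b\preceq C$ can be justified. (f) $p/E<5/18$. **Algorithm.** Below $s(t)$ is the slot of $t$, $K(s_1,s_2)$ is the union of the committees of slots $s_1\le s<s_2$ in the view of $v$ at $t$, and everything is evaluated by $v$. * $\mathrm{willChkpBeJustified}(b,e,t)$, with $C=C(b,e)$: the weight $|\cdot|_C$ of the signers in $K(\mathrm{fs}(e),s(t))$ of FFG votes $VS(b,e)\to C$ in $\mathcal V^{v,t}$, plus $(1-\beta)\,|K(s(t),\mathrm{fs}(e+1))|_C$, is at least $\frac23|\mathrm{all}|_C+\min(W,\beta|\mathrm{all}|_C)$. * $\mathrm{isLMDGHOSTSafe}(b,C,t)$: for every non-genesis $b'\preceq b$, with $S=K(\mathrm{slot}(\mathrm{parent}(b'))+1,s(t))$, the fraction ($|\cdot|_C$) of $S$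 formed by its members whose GHOST votes remaining after the LMD-GHOST filters support $b'$ is greater than $\frac12\left(1+\frac{(p/E)|\mathrm{all}|_C}{|S|_C}\right)+\beta$. * $\mathrm{isConfirmedNoCaching}(b,t)$, with $e=\mathrm{epoch}(t)$: if $\mathrm{epoch}(b)=e$: $\mathrm{willChkpBeJustified}(b,e,t)$, $\mathrm{epoch}(GJ(b))=e-1$ and $\mathrm{isLMDGHOSTSafe}(b,GJ(b),t)$. Otherwise: $s(t)=\mathrm{fs}(e)$, $\mathrm{willChkpBeJustified}(b,e-1,t)$, and the view of $v$ at $\mathrm{st}(s(t)-1)$ has a block $b'\succeq b$ with $\mathrm{epoch}(b')<e$, $\mathrm{epoch}(VS(b',e))\ge e-2$ and $\mathrm{isLMDGHOSTSafe}(b,VS(b',e),t)$. * $\mathrm{isConfirmed}_v(b,t)$: $b\preceq h$, where $h$ is a highest-slot block among the blocks $b''$ for which there is a slot $s$ with $\mathrm{fs}(\mathrm{epoch}(t)-1)+1\le s\le s(t)$, $b''\in\mathcal V^{v,\mathrm{st}(s)}$ and $\mathrm{isConfirmedNoCaching}(b'',\mathrm{st}(s))$ (false if there is no such block). The security guard $\mathsf{sg}(b,t,\mathsf{GGST})$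 is: $\mathrm{epoch}(b)\ge\mathrm{epoch}(t)-1$ and $\mathrm{st}(\mathrm{epoch}(t)-1)\ge\mathsf{GGST}$. **Theorem.** Under these assumptions, $(\mathrm{isConfirmed},\mathsf{sg})$ is a Confirmation Rule for $\text{LMD-GHOST-HFC}^{GJ}$: for every honest $v$, block $b$ and time $t$ with $\mathsf{sg}(b,t,\mathsf{GGST})$ and $\mathrm{isConfirmed}_v(b,t)$, * (Safety) there is a time $t_0$ such that for all $t'\ge t_0$ and all honest $v'$, $b$ is on the canonical chain of $v'$ at $t'$; * (Monotonicity) $\mathrm{isConfirmed}_v(b,t')$ for all $t'\ge t$. -/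

import Mathlib

open scoped NNReal ENNReal

noncomputable section

namespace Gasper

/-- Points in time; the protocol starts at time `0`. -/
abbrev Time := ℝ≥0

/-- A checkpoint is a pair of a block and an epoch. -/
@[ext]
structure Checkpoint (B : Type*) where
  block : B
  epoch : ℕ

/-- A GHOST vote, together with its signer. -/
@[ext]
structure GhostVote (V B : Type*) where
  signer : V
  slot : ℕ
  block : B

/-- An FFG vote `source → target`, together with its signer. -/
@[ext]
structure FFGVote (V B : Type*) where
  signer : V
  source : Checkpoint B
  target : Checkpoint B

/-- The messages that validators exchange. -/
inductive Message (V B : Type*) where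
  | block (b : B) : Message V B
  | ghost (a : GhostVote V B) : Message V B
  | ffg (a : FFGVote V B) : Message V B

/-- The weight of a set `X` of validators under an effective-balance assignment `w`
(only finitely many validators have a non-zero balance). -/
def weight {V : Type*} (w : V →₀ ℝ≥0) (X : Set V) : ℝ :=
  open Classical in ∑ i ∈ w.support.filter (fun i => i ∈ X), (w i : ℝ)

/-- The weight of the total validator set of an effective-balance assignment. -/
def totalWeight {V : Type*} (w : V →₀ ℝ≥0) : ℝ := weight w Set.univ

/-- The static data of the protocol: the clock, the tree of all possible valid blocks, and what
each block records (effective balances, justified and finalized checkpoints, slashed validators).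
`B` is the type of *valid* blocks: invalid blocks, and votes for them, are ignored by honest
validators and are not represented. -/
structure Protocol (V B : Type*) where
  /-- Number of slots per epoch. -/
  slotsPerEpoch : ℕ
  two_le_slotsPerEpoch : 2 ≤ slotsPerEpoch
  /-- Start time of each slot. -/
  slotStart : ℕ → Time
  slotStart_strictMono : StrictMono slotStart
  /-- The slot to which a time belongs. -/
  slotAt : Time → ℕ
  slotStart_le_iff : ∀ s t, slotStart s ≤ t ↔ s ≤ slotAt t
  /-- The genesis block. -/
  gen : B
  /-- The parent of a block; the genesis block, which has no parent, is sent to itself. -/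
  parent : B → B
  parent_gen : parent gen = gen
  /-- The slot of a block. -/
  slot : B → ℕ
  slot_gen : slot gen = 0
  slot_parent_lt : ∀ b, b ≠ gen → slot (parent b) < slot b
  /-- The effective-balance assignment of a block. -/
  eba : B → V →₀ ℝ≥0
  /-- The set of unrealized justified checkpoints of the chain of a block. -/
  justified : B → Set (Checkpoint B)
  /-- The set of finalized checkpoints according to a block. -/
  finalized : B → Set (Checkpoint B)
  /-- The validators that committed slashable offences according to the evidence included in the
  chain of a block. -/
  slashed : B → Set V
  /-- The proposer boost score `p`. -/
  boostScore : ℝ≥0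

namespace Protocol

variable {V B : Type*} (P : Protocol V B)

/-! ### Slots and epochs -/

/-- The epoch of a slot. -/
def epochOfSlot (s : ℕ) : ℕ := s / P.slotsPerEpoch

/-- The first slot of an epoch. -/
def firstSlot (e : ℕ) : ℕ := e * P.slotsPerEpoch

/-- The last slot of an epoch. -/
def lastSlot (e : ℕ) : ℕ := (e + 1) * P.slotsPerEpoch - 1

/-- The start time of an epoch. -/
def epochStart (e : ℕ) : Time := P.slotStart (P.firstSlot e)

/-- The epoch of a time. -/
def epochAt (t : Time) : ℕ := P.epochOfSlot (P.slotAt t)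

/-- The epoch of a block. -/
def epoch (b : B) : ℕ := P.epochOfSlot (P.slot b)

/-- The time `GGST` determined by the global stabilization time `GST`. -/
def ggst (GST : Time) : Time :=
  if GST ≤ P.slotStart (P.lastSlot (P.epochAt GST)) then P.epochStart (P.epochAt GST + 1)
  else P.epochStart (P.epochAt GST + 2)

/-! ### Blocks and checkpoints -/

/-- `a ⪯ b`: block `a` is reached from `b` by following parents (possibly in zero steps). -/
def Anc (a b : B) : Prop := ∃ k : ℕ, P.parent^[k] b = a

/-- The checkpoint `C(b, e)`: its block is the block of the chain of `b` with the highest slot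
among those whose slot is at most the first slot of `e`, that is, the first such block met when
following parents from `b`. -/
def chkp (b : B) (e : ℕ) : Checkpoint B :=
  ⟨P.parent^[sInf {k | P.slot (P.parent^[k] b) ≤ P.firstSlot e}] b, e⟩

/-- The genesis checkpoint. -/
def genChkp : Checkpoint B := ⟨P.gen, 0⟩

/-- `C ⪯ b` for a checkpoint `C` and a block `b`. -/
def ChkpAncBlock (C : Checkpoint B) (b : B) : Prop := P.chkp b C.epoch = C

/-- `b ⪯ C` for a block `b` and a checkpoint `C`. -/
def BlockAncChkp (b : B) (C : Checkpoint B) : Prop := P.Anc b C.block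

/-- `C ⪯ C'` for checkpoints. -/
def ChkpAnc (C C' : Checkpoint B) : Prop :=
  C = C' ∨ (C.epoch < C'.epoch ∧ P.ChkpAncBlock C C'.block)

/-- The checkpoint `C` conflicts with the block `b`. -/
def Conflicts (C : Checkpoint B) (b : B) : Prop := ¬ P.ChkpAncBlock C b ∧ ¬ P.BlockAncChkp b C

/-- `C` is justified by some possible valid block. Its negation says that `C` can never be
justified. -/
def CanBeJustified (C : Checkpoint B) : Prop := ∃ b, C ∈ P.justified b

/-- A checkpoint of the highest epoch in `S`, ties being broken arbitrarily (the genesis checkpoint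
if there is none, for instance if `S` is empty). -/
def greatest (S : Set (Checkpoint B)) : Checkpoint B :=
  open Classical in
  if h : ∃ C ∈ S, ∀ C' ∈ S, C'.epoch ≤ C.epoch then h.choose else P.genChkp

/-- `GU(b)`, the greatest unrealized justified checkpoint in the chain of `b`. -/
def gu (b : B) : Checkpoint B := P.greatest (P.justified b)

/-- `GF(b)`, the greatest finalized checkpoint in the chain of `b`. -/
def gf (b : B) : Checkpoint B := P.greatest (P.finalized b)

/-- The highest block of the chain of `b` with an epoch lower than that of `b` (meaningful if the
epoch of `b` is positive). -/
def prevEpochBlock (b : B) : B :=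
  P.parent^[sInf {k | P.epoch (P.parent^[k] b) < P.epoch b}] b

/-- `GJ(b)`, the greatest justified checkpoint in the chain of `b`; for a block of epoch `0`, whose
chain has no block of an earlier epoch, this is the genesis checkpoint. -/
def gj (b : B) : Checkpoint B :=
  if P.epoch b = 0 then P.genChkp else P.gu (P.prevEpochBlock b)

/-- `VS(b, e)`, the voting source of `b` in epoch `e`; used only for blocks of epoch at most `e`. -/
def votingSource (b : B) (e : ℕ) : Checkpoint B :=
  if P.epoch b < e then P.gu b else P.gj b

/-- The proposer boost weight according to an effective-balance assignment. -/
def boostWeight (w : V →₀ ℝ≥0) : ℝ := P.boostScore / P.slotsPerEpoch * totalWeight w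

/-! ### Views -/

/-- The blocks in a view. -/
def blocksOf (M : Set (Message V B)) : Set B := {b | Message.block b ∈ M}

/-- The GHOST votes in a view. -/
def ghostsOf (M : Set (Message V B)) : Set (GhostVote V B) := {a | Message.ghost a ∈ M}

/-- The signers of the FFG votes `C₁ → C₂` in a view. -/
def ffgVoters (M : Set (Message V B)) (C₁ C₂ : Checkpoint B) : Set V :=
  {i | Message.ffg ⟨i, C₁, C₂⟩ ∈ M}

/-- The signers of the FFG votes with target `C` (and any source) in a view. -/
def ffgTargetVoters (M : Set (Message V B)) (C : Checkpoint B) : Set V :=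
  {i | ∃ C₁, Message.ffg ⟨i, C₁, C⟩ ∈ M}

/-- The greatest justified checkpoint in a view at time `t`. -/
def gjView (M : Set (Message V B)) (t : Time) : Checkpoint B :=
  P.greatest {C | ∃ b ∈ blocksOf M, P.slot b ≤ P.slotAt t ∧ C = P.votingSource b (P.epochAt t)}

/-- The greatest finalized checkpoint in a view at time `t`. -/
def gfView (M : Set (Message V B)) (t : Time) : Checkpoint B :=
  P.greatest {C | ∃ b ∈ blocksOf M, P.slot b ≤ P.slotAt t ∧ C = P.gf b}

/-- The children of `b` in a view that are not from a future slot. -/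
def children (M : Set (Message V B)) (t : Time) (b : B) : Set B :=
  {c | c ∈ blocksOf M ∧ c ≠ P.gen ∧ P.parent c = b ∧ P.slot c ≤ P.slotAt t}

/-- `GS(b, M)`: the validators that have voted in support of `b`. -/
def ghostVoters (M : Set (Message V B)) (b : B) : Set V :=
  {i | ∃ a ∈ ghostsOf M, a.signer = i ∧ P.Anc b a.block}

/-! ### The filters -/

/-- Remove the GHOST votes of validators that have equivocated. -/
def filEq (M : Set (Message V B)) : Set (Message V B) :=
  M \ {m | ∃ a, m = Message.ghost a ∧ ∃ a₁ ∈ ghostsOf M, ∃ a₂ ∈ ghostsOf M,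
    a₁.signer = a.signer ∧ a₂.signer = a.signer ∧ a₁.slot = a₂.slot ∧ a₁.block ≠ a₂.block}

/-- Remove the GHOST votes from the current or from future slots. -/
def filCur (M : Set (Message V B)) (t : Time) : Set (Message V B) :=
  M \ {m | ∃ a, m = Message.ghost a ∧ P.slotAt t ≤ a.slot}

/-- Remove the invalid GHOST votes; `K s` is the committee of slot `s`. -/
def filInv (K : ℕ → Finset V) (M : Set (Message V B)) : Set (Message V B) :=
  M \ {m | ∃ a, m = Message.ghost a ∧ (a.signer ∉ K a.slot ∨ a.slot < P.slot a.block)}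

/-- Keep only the GHOST votes with the highest slot of each validator. -/
def filLmd (M : Set (Message V B)) : Set (Message V B) :=
  M \ {m | ∃ a, m = Message.ghost a ∧ ∃ a₁ ∈ ghostsOf M, a₁.signer = a.signer ∧ a.slot < a₁.slot}

/-- The filters of LMD-GHOST combined. -/
def filLmdGhost (K : ℕ → Finset V) (M : Set (Message V B)) (t : Time) : Set (Message V B) :=
  filLmd (P.filInv K (P.filCur (filEq M) t))

/-- Condition for a block not to be removed by the FFG filter. -/
def KeptByHFC (M : Set (Message V B)) (t : Time) (b : B) : Prop :=
  P.BlockAncChkp b (P.gjView M t) ∨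
    (P.Anc (P.gjView M t).block b ∧
      ∃ b' ∈ blocksOf M, P.Anc b b' ∧ P.ChkpAncBlock (P.gfView M t) b' ∧
        P.epoch b' ≤ P.epochAt t ∧ P.children M t b' = ∅ ∧
        (P.votingSource b' (P.epochAt t) = P.gjView M t ∨
          P.epochAt t ≤ (P.votingSource b' (P.epochAt t)).epoch + 2))

/-- The FFG filter. -/
def filHfc (M : Set (Message V B)) (t : Time) : Set (Message V B) :=
  M \ {m | ∃ b, m = Message.block b ∧ ¬ P.KeptByHFC M t b}

/-! ### The fork choice -/

/-- The weight that GHOST gives to a block: the weight of the validators voting in support of it,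
plus the proposer boost weight if the currently boosted block, if any, descends from it. -/
def ghostWeight (w : V →₀ ℝ≥0) (boosted : Option B) (M : Set (Message V B)) (b : B) : ℝ :=
  open Classical in
  weight w (P.ghostVoters M b) +
    if ∃ x ∈ boosted, P.Anc b x then P.boostWeight w else 0

/-- One iteration of GHOST: move to a heaviest child, chosen by `tie`, if there is a child. -/
def ghostStep (tie : Set B → B) (w : V →₀ ℝ≥0) (boosted : Option B) (M : Set (Message V B))
    (t : Time) (b : B) : B :=
  open Classical in
  if (P.children M t b).Nonempty then
    tie {c | c ∈ P.children M t b ∧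
      ∀ c' ∈ P.children M t b, P.ghostWeight w boosted M c' ≤ P.ghostWeight w boosted M c}
  else b

/-- GHOST: start from the genesis block and iterate as long as there are children. As slots
increase from parent to child, and the slots of the blocks considered are at most the current
slot, `slotAt t + 1` iterations are enough. -/
def ghost (tie : Set B → B) (w : V →₀ ℝ≥0) (boosted : Option B) (M : Set (Message V B))
    (t : Time) : B :=
  (P.ghostStep tie w boosted M t)^[P.slotAt t + 1] P.gen

/-- LMD-GHOST. -/
def lmdGhost (tie : Set B → B) (K : ℕ → Finset V) (w : V →₀ ℝ≥0) (boosted : Option B)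
    (M : Set (Message V B)) (t : Time) : B :=
  P.ghost tie w boosted (P.filLmdGhost K M t) t

/-- LMD-GHOST-HFC, with votes weighed according to the greatest justified checkpoint. -/
def lmdGhostHfc (tie : Set B → B) (K : ℕ → Finset V) (boosted : Option B)
    (M : Set (Message V B)) (t : Time) : B :=
  P.lmdGhost tie K (P.eba (P.gjView M t).block) boosted (P.filHfc M t) t

end Protocol

/-- The data of an execution of the protocol. -/
structure Execution {V B : Type*} (P : Protocol V B) where
  /-- The honest validators; all the others are Byzantine. -/
  honest : Set V
  /-- The global stabilization time. -/
  GST : Time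
  /-- The maximum message latency after `GST`. -/
  Δ : Time
  /-- `broadcast i t`: the messages sent by validator `i` at time `t`. -/
  broadcast : V → Time → Set (Message V B)
  /-- `view v t`: the messages received by validator `v` by time `t`. -/
  view : V → Time → Set (Message V B)
  /-- `committee v t s`: the committee of slot `s` in the view of validator `v` at time `t`. -/
  committee : V → Time → ℕ → Finset V
  /-- The time, during slot `s`, at which `v` votes if it is in the committee of slot `s`. -/
  voteTime : V → ℕ → Time
  /-- The block, if any, to which `v` gives the proposer boost at time `t`. -/
  boosted : V → Time → Option B
  /-- The rule used to break ties between heaviest children. -/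
  tie : Set B → B

namespace Execution

variable {V B : Type*} {P : Protocol V B} (X : Execution P)

/-- The time `GGST` of the execution. -/
def ggst : Time := P.ggst X.GST

/-- All the messages sent by time `t`, by any validator. -/
def sent (t : Time) : Set (Message V B) := {m | ∃ i, ∃ t' ≤ t, m ∈ X.broadcast i t'}

/-- The union of the committees of the slots `s ≤ k < s'`. -/
def committees (v : V) (t : Time) (s s' : ℕ) : Set V :=
  {i | ∃ k, s ≤ k ∧ k < s' ∧ i ∈ X.committee v t k}

/-- The validator set of epoch `e`. -/
def validatorSet (v : V) (t : Time) (e : ℕ) : Set V :=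
  X.committees v t (P.firstSlot e) (P.firstSlot (e + 1))

/-- The greatest justified checkpoint in the view of `v` at time `t`. -/
def gjAt (v : V) (t : Time) : Checkpoint B := P.gjView (X.view v t) t

/-- The greatest finalized checkpoint in the view of `v` at time `t`. -/
def gfAt (v : V) (t : Time) : Checkpoint B := P.gfView (X.view v t) t

/-- The canonical chain of `v` at time `t` according to LMD-GHOST-HFC. -/
def forkChoice (v : V) (t : Time) : B :=
  P.lmdGhostHfc X.tie (X.committee v t) (X.boosted v t) (X.view v t) t

/-- Validator `v` is to vote in slot `s`, according to its own view. -/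
def VotesIn (v : V) (s : ℕ) : Prop := v ∈ X.committee v (X.voteTime v s) s

/-- The GHOST vote of an honest validator for slot `s`. -/
def ghostVote (v : V) (s : ℕ) : GhostVote V B := ⟨v, s, X.forkChoice v (X.voteTime v s)⟩

/-- The FFG vote of an honest validator for slot `s`. -/
def ffgVote (v : V) (s : ℕ) : FFGVote V B :=
  ⟨v, P.votingSource (X.forkChoice v (X.voteTime v s)) (P.epochOfSlot s),
    P.chkp (X.forkChoice v (X.voteTime v s)) (P.epochOfSlot s)⟩

/-- The rules of the system model: the network, honest behaviour, committees. -/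
structure FollowsProtocol : Prop where
  /-- Ties are broken in favour of one of the candidates. -/
  tie_mem : ∀ S : Set B, S.Nonempty → X.tie S ∈ S
  view_mono : ∀ v ∈ X.honest, ∀ t t', t ≤ t' → X.view v t ⊆ X.view v t'
  view_finite : ∀ v ∈ X.honest, ∀ t, (X.view v t).Finite
  gen_mem_view : ∀ v ∈ X.honest, ∀ t, Message.block P.gen ∈ X.view v t
  /-- Honest validators immediately gossip any message that they receive. -/
  gossip : ∀ v ∈ X.honest, ∀ t, ∀ m ∈ X.view v t, ∃ t' ≤ t, m ∈ X.broadcast v t'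
  /-- A message sent at time `t` is received by time `max t GST + Δ`. -/
  delivery : ∀ v ∈ X.honest, ∀ t, ∀ m ∈ X.broadcast v t, ∀ v' ∈ X.honest,
    m ∈ X.view v' (max t X.GST + X.Δ)
  /-- Honest validators vote during the slot, more than `Δ` before its end. -/
  voteTime_slot : ∀ v ∈ X.honest, ∀ s, P.slotAt (X.voteTime v s) = s
  voteTime_lt : ∀ v ∈ X.honest, ∀ s, X.voteTime v s + X.Δ < P.slotStart (s + 1)
  /-- Honest members of the committee of a slot cast one vote of each type. -/
  casts_ghost : ∀ v ∈ X.honest, ∀ s, X.VotesIn v s →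
    Message.ghost (X.ghostVote v s) ∈ X.broadcast v (X.voteTime v s)
  casts_ffg : ∀ v ∈ X.honest, ∀ s, X.VotesIn v s →
    Message.ffg (X.ffgVote v s) ∈ X.broadcast v (X.voteTime v s)
  /-- Honest validators sign no other votes, and signatures cannot be forged. -/
  ghost_unforgeable : ∀ t a, Message.ghost a ∈ X.sent t → a.signer ∈ X.honest →
    ∃ s, X.VotesIn a.signer s ∧ X.voteTime a.signer s ≤ t ∧ a = X.ghostVote a.signer s
  ffg_unforgeable : ∀ t a, Message.ffg a ∈ X.sent t → a.signer ∈ X.honest →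
    ∃ s, X.VotesIn a.signer s ∧ X.voteTime a.signer s ≤ t ∧ a = X.ffgVote a.signer s
  /-- After `GGST`, honest validators have the same view on the committees. -/
  committee_agree : ∀ v ∈ X.honest, ∀ v' ∈ X.honest, ∀ t t', X.ggst ≤ t → X.ggst ≤ t' →
    X.committee v t = X.committee v' t'
  /-- The committees of an epoch partition its validator set. -/
  committee_disjoint : ∀ v ∈ X.honest, ∀ t s s', s ≠ s' → P.epochOfSlot s = P.epochOfSlot s' →
    Disjoint (X.committee v t s) (X.committee v t s')
  /-- The validator set of the epoch of the genesis block is the total validator set of that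
  block. -/
  validatorSet_gen : ∀ v ∈ X.honest, ∀ t, X.ggst ≤ t →
    X.validatorSet v t 0 = {i | 0 < P.eba P.gen i}
  /-- Honest validators commit no slashable offence. -/
  honest_not_slashed : ∀ v ∈ X.honest, ∀ b, v ∉ P.slashed b

/-- The properties ensured by Gasper that are taken as given. The first six fields spell out what
the sets of unrealized justified and finalized checkpoints of a chain are; they include
`epoch (GU b) ≤ epoch b`. -/
structure GasperProperties (β safetyDecay : ℝ) : Prop where
  gen_justified : P.genChkp ∈ P.justified P.gen
  justified_mono : ∀ b b', P.Anc b b' → P.justified b ⊆ P.justified b'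
  justified_in_chain : ∀ b, ∀ C ∈ P.justified b, P.ChkpAncBlock C b
  justified_epoch_le : ∀ b, ∀ C ∈ P.justified b, C.epoch ≤ P.epoch b
  finalized_subset : ∀ b, P.finalized b ⊆ P.justified b
  gen_finalized : ∀ b, P.genChkp ∈ P.finalized b
  /-- No two checkpoints for the same epoch can ever be justified. -/
  justified_unique : β < 1 / 3 - safetyDecay → ∀ C₁ C₂ : Checkpoint B,
    P.CanBeJustified C₁ → P.CanBeJustified C₂ → C₁.epoch = C₂.epoch → C₁ = C₂
  /-- The greatest justified checkpoint descends from the greatest finalized checkpoint. -/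
  gf_anc_gj : ∀ v ∈ X.honest, ∀ t, P.ChkpAnc (X.gfAt v t) (X.gjAt v t)
  /-- FFG votes of two thirds of the validators prevent the justification of any other checkpoint
  for the same epoch. -/
  no_other_justified : β < 1 / 3 - safetyDecay → ∀ v ∈ X.honest, ∀ t, ∀ C : Checkpoint B,
    (P.ChkpAnc (X.gjAt v t) C ∨
      ∃ D, P.CanBeJustified D ∧ D.epoch + 1 = C.epoch ∧ P.ChkpAnc D C) →
    2 / 3 * totalWeight (P.eba C.block) ≤
      weight (P.eba C.block) (Protocol.ffgTargetVoters (X.sent t) C) →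
    ∀ C' : Checkpoint B, C'.epoch = C.epoch → C' ≠ C → ¬ P.CanBeJustified C'
  /-- If all the honest validators of an epoch after `GGST` send FFG votes targeting descendants of
  `b`, then no checkpoint for that epoch that conflicts with `b` can ever be justified. -/
  no_conflicting_justified : β < 1 / 3 - safetyDecay → ∀ b e, X.ggst ≤ P.epochStart e →
    (∀ v ∈ X.honest, ∀ t, X.ggst ≤ t → ∀ i ∈ X.validatorSet v t e ∩ X.honest,
      ∃ C, P.BlockAncChkp b C ∧ C.epoch = e ∧
        i ∈ Protocol.ffgTargetVoters (X.sent (P.epochStart (e + 1))) C) →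
    ∀ C : Checkpoint B, C.epoch = e → P.Conflicts C b → ¬ P.CanBeJustified C
  boost_lt : (P.boostScore : ℝ) / P.slotsPerEpoch < 5 / 18

/-- The validator set and the effective balances only change because of Byzantine validators being
slashed. -/
structure FixedValidatorSet : Prop where
  validatorSet_subset : ∀ v ∈ X.honest, ∀ t, X.ggst ≤ t → ∀ e,
    X.validatorSet v t e ⊆ {i | 0 < P.eba P.gen i}
  honest_validatorSet : ∀ v ∈ X.honest, ∀ t, X.ggst ≤ t → ∀ e,
    X.validatorSet v t e ∩ X.honest = {i | 0 < P.eba P.gen i} ∩ X.honest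
  eba_anti : ∀ b b', P.Anc b b' → ∀ i, P.eba b' i ≤ P.eba b i
  eba_eq : ∀ b b', P.Anc b b' → ∀ i, i ∉ P.slashed b' → P.eba b' i = P.eba b i

/-- The bound `β` on the fraction of Byzantine weight in any range of committees. -/
def BetaBound (β : ℝ) : Prop :=
  0 ≤ β ∧ ∀ v ∈ X.honest, ∀ t, X.ggst ≤ t → ∀ s s' b, ∀ C ∈ P.justified b,
    (1 - β) * weight (P.eba C.block) (X.committees v t s s') ≤
      weight (P.eba C.block) (X.committees v t s s' ∩ X.honest)

/-- Validators with a total effective balance of at most `W` ever get slashed. -/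
def SlashingBound (_X : Execution P) (W : ℝ≥0∞) : Prop :=
  ∀ b, ENNReal.ofReal (weight (P.eba P.gen) (P.slashed b)) ≤ W

/-- `honFFGratio(β)`. -/
def honFFGRatio (β : ℝ) : ℝ := 1 / (1 - β) * (2 / 3 + β)

/-- The strong FFG-justification assumption: if `b` is canonical for all honest validators for the
entire epoch `e + 1` and `C(b, e)` has received the FFG votes of two thirds of the validators, then
a checkpoint `C` of epoch `e + 1` that descends from `b` receives enough honest FFG votes, and a
block that descends from `C` and justifies `C(b, e)` is received by the beginning of the last slot
of epoch `e + 1`. -/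
def StrongJustification (β : ℝ) : Prop :=
  ∀ b e, P.epoch b ≤ e → X.ggst ≤ P.epochStart (e + 1) →
    (∀ t, P.epochAt t = e + 1 → ∀ v ∈ X.honest,
      P.Anc b (X.forkChoice v t) ∧
      ∀ b' ∈ Protocol.blocksOf (X.view v t), P.ChkpAncBlock (P.chkp b e) b' →
        2 / 3 * totalWeight (P.eba b') ≤
          weight (P.eba b')
            (Protocol.ffgVoters (X.sent t) (P.votingSource b e) (P.chkp b e) \ P.slashed b')) →
    ∀ v ∈ X.honest, ∃ C : Checkpoint B,
      C.epoch = e + 1 ∧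
      P.BlockAncChkp b C ∧
      (∃ b' ∈ Protocol.blocksOf (X.view v (P.slotStart (P.lastSlot (e + 1)))),
        P.ChkpAncBlock C b' ∧ P.epoch b' < e + 2 ∧ P.chkp b e ∈ P.justified b') ∧
      ∀ t', P.epochStart (e + 2) ≤ t' →
        honFFGRatio β * weight (P.eba C.block) X.honest <
          weight (P.eba C.block)
            (Protocol.ffgVoters (X.view v t') (P.votingSource C.block C.epoch) C ∩ X.honest)

/-! ### The confirmation rule -/

/-- The committees from the slot after the parent of `b` up to the slot before that of `t`. -/
def blockCommittees (v : V) (t : Time) (b : B) : Set V :=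
  X.committees v t (P.slot (P.parent b) + 1) (P.slotAt t)

/-- The members of these committees whose GHOST votes LMD-GHOST support `b`. -/
def support (v : V) (t : Time) (b : B) : Set V :=
  P.ghostVoters (P.filLmdGhost (X.committee v t) (X.view v t) t) b ∩ X.blockCommittees v t b

/-- The LMD-GHOST safety indicator `Q` of `b` at time `t`, for committees up to the slot before
that of `t`. -/
def indicatorQ (v : V) (t : Time) (w : V →₀ ℝ≥0) (b : B) : ℝ :=
  weight w (X.support v t b) / weight w (X.blockCommittees v t b)

/-- The LMD-GHOST safety condition for `b` according to the checkpoint `C`. -/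
def isLMDGHOSTSafe (β : ℝ) (v : V) (b : B) (C : Checkpoint B) (t : Time) : Prop :=
  ∀ b', P.Anc b' b → b' = P.gen ∨
    1 / 2 * (1 + P.boostWeight (P.eba C.block) /
        weight (P.eba C.block) (X.blockCommittees v t b')) + β <
      X.indicatorQ v t (P.eba C.block) b'

/-- The function `willChkpBeJustified`. -/
def willChkpBeJustified (β : ℝ) (W : ℝ≥0∞) (v : V) (b : B) (e : ℕ) (t : Time) : Prop :=
  let w := P.eba (P.chkp b e).block
  2 / 3 * totalWeight w + (min W (ENNReal.ofReal (β * totalWeight w))).toReal ≤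
    weight w (Protocol.ffgVoters (X.view v t) (P.votingSource b e) (P.chkp b e) ∩
        X.committees v t (P.firstSlot e) (P.slotAt t)) +
      (1 - β) * weight w (X.committees v t (P.slotAt t) (P.firstSlot (e + 1)))

/-- The function `isConfirmedNoCaching`. -/
def isConfirmedNoCaching (β : ℝ) (W : ℝ≥0∞) (v : V) (b : B) (t : Time) : Prop :=
  if P.epoch b = P.epochAt t then
    X.willChkpBeJustified β W v b (P.epochAt t) t ∧
    (P.gj b).epoch + 1 = P.epochAt t ∧
    X.isLMDGHOSTSafe β v b (P.gj b) t
  else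
    P.slotAt t = P.firstSlot (P.epochAt t) ∧
    X.willChkpBeJustified β W v b (P.epochAt t - 1) t ∧
    ∃ b' ∈ Protocol.blocksOf (X.view v (P.slotStart (P.slotAt t - 1))),
      P.Anc b b' ∧
      P.epoch b' < P.epochAt t ∧
      P.epochAt t ≤ (P.votingSource b' (P.epochAt t)).epoch + 2 ∧
      X.isLMDGHOSTSafe β v b (P.votingSource b' (P.epochAt t)) t

/-- The blocks found to be confirmed at the start of a slot from the second slot of epoch `e` to
the slot of `t`. -/
def confirmedSinceEpoch (β : ℝ) (W : ℝ≥0∞) (v : V) (e : ℕ) (t : Time) : Set B :=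
  {b | ∃ s, P.firstSlot e + 1 ≤ s ∧ s ≤ P.slotAt t ∧
    b ∈ Protocol.blocksOf (X.view v (P.slotStart s)) ∧
    X.isConfirmedNoCaching β W v b (P.slotStart s)}

/-- The function `highestConfirmedSinceEpoch`: a block of the highest slot among these, ties being
broken arbitrarily (`none` if there is none). -/
def highestConfirmedSinceEpoch (β : ℝ) (W : ℝ≥0∞) (v : V) (e : ℕ) (t : Time) : Option B :=
  open Classical in
  if h : ∃ b ∈ X.confirmedSinceEpoch β W v e t, ∀ b' ∈ X.confirmedSinceEpoch β W v e t,
      P.slot b' ≤ P.slot b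
  then some h.choose else none

/-- The function `isConfirmed`. -/
def isConfirmed (β : ℝ) (W : ℝ≥0∞) (v : V) (b : B) (t : Time) : Prop :=
  ∃ h ∈ X.highestConfirmedSinceEpoch β W v (P.epochAt t - 1) t, P.Anc b h

/-- The security guard: `epoch b ≥ epoch t - 1` and epoch `epoch t - 1` starts at or after `GGST`.
(If `epoch t = 0`, then the second condition fails, as epoch `0` starts before `GGST`.) -/
def securityGuard (P : Protocol V B) (b : B) (t ggst : Time) : Prop :=
  P.epochAt t ≤ P.epoch b + 1 ∧ ggst ≤ P.epochStart (P.epochAt t - 1)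

/-- `(isConf, sg)` is a Confirmation Rule for the fork choice `fc`: for honest validators, and for
the blocks and times that pass the security guard, it satisfies Safety and Monotonicity. -/
def IsConfirmationRule (fc : V → Time → B) (isConf : V → B → Time → Prop)
    (sg : B → Time → Time → Prop) : Prop :=
  ∀ b t, sg b t X.ggst → ∀ v ∈ X.honest, isConf v b t →
    (∃ t₀, ∀ v' ∈ X.honest, ∀ t', t₀ ≤ t' → P.Anc b (fc v' t')) ∧
    (∀ t', t ≤ t' → isConf v b t')

end Execution

end Gasper

end

/-! Safety rests on two invariants, one for GHOST votes and one for FFG votes, which are carried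
through time together.

GHOST side. Honest validators are never slashed, so the weight of a set of honest validators is the
same according to every block (`weight_inter_honest`). The LMD-GHOST safety condition therefore
yields an inequality whose vote weights are honest only (`honestSupport_margin`). It survives both
the arrival of new committees, as long as their honest members vote for the block, and the passage
to the smaller balances of a later checkpoint (`ghostVoters_margin`). The supporters of a block then
outweigh those of any sibling by more than the proposer boost, so GHOST follows the block, provided
the FFG filter keeps its chain (`anc_forkChoice`).

FFG side. A checkpoint of epoch `e` on the chain of the block, once voted for by two thirds with
room for slashing, excludes every other justified checkpoint of epoch `e`. Hence the greatest
justified checkpoint seen in epoch `e + 1` is comparable with the block (`gjAt_comparable`), and the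
filter keeps the block because the leaves above it have recent voting sources (`keptByHFC`). Strong
induction on slots, in which earlier honest votes supply the votes needed now, makes the block
canonical for the rest of its epoch and for the next one.

From epoch to epoch. Strong FFG justification turns a block canonical during epoch `e + 1` into a
checkpoint of that epoch above it with so many honest votes that its block passes all the tests at
the start of epoch `e + 2` (`exists_confirmedAtEpochStart`). The argument restarts from there, and
so covers all later epochs.

Monotonicity. By the same induction, every relevant epoch has a confirmed descendant of the block.
The highest confirmed block and that descendant are both canonical at one common later time, hence
lie on one chain, and the comparison of slots puts the descendant below (`isConfirmed_of_mem`). -/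

namespace Gasper

/-! ### Weights of sets of validators. -/

section Weight

variable {V : Type*}

open Classical in
theorem weight_eq_sum (w : V →₀ ℝ≥0) (S : Set V) {T : Finset V} (hT : w.support ⊆ T) :
    weight w S = ∑ i ∈ T, if i ∈ S then (w i : ℝ) else 0 := by
  unfold weight
  rw [Finset.sum_filter]
  refine Finset.sum_subset hT fun i _ hi => ?_
  simp [Finsupp.notMem_support_iff.mp hi]

theorem weight_nonneg (w : V →₀ ℝ≥0) (S : Set V) : 0 ≤ weight w S :=
  Finset.sum_nonneg fun i _ => (w i).coe_nonneg

theorem weight_le_weight {w w' : V →₀ ℝ≥0} {S S' : Set V}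
    (h : ∀ i ∈ S, 0 < w i → i ∈ S' ∧ w i ≤ w' i) : weight w S ≤ weight w' S' := by
  classical
  rw [weight_eq_sum w S (T := w.support ∪ w'.support) Finset.subset_union_left,
    weight_eq_sum w' S' (T := w.support ∪ w'.support) Finset.subset_union_right]
  refine Finset.sum_le_sum fun i _ => ?_
  by_cases hi : i ∈ S
  · rcases eq_or_lt_of_le (zero_le (a := w i)) with h0 | h0
    · rw [if_pos hi, ← h0]
      split_ifs <;> simp
    · rw [if_pos hi, if_pos (h i hi h0).1]
      exact_mod_cast (h i hi h0).2
  · rw [if_neg hi]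
    split_ifs <;> simp

theorem weight_mono (w : V →₀ ℝ≥0) {S S' : Set V} (h : S ⊆ S') : weight w S ≤ weight w S' :=
  weight_le_weight fun _ hi _ => ⟨h hi, le_rfl⟩

theorem weight_union (w : V →₀ ℝ≥0) {S S' : Set V} (h : Disjoint S S') :
    weight w (S ∪ S') = weight w S + weight w S' := by
  classical
  rw [weight_eq_sum w _ subset_rfl, weight_eq_sum w S subset_rfl, weight_eq_sum w S' subset_rfl,
    ← Finset.sum_add_distrib]
  refine Finset.sum_congr rfl fun i _ => ?_
  by_cases h1 : i ∈ S
  · have h2 : i ∉ S' := Set.disjoint_left.mp h h1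
    simp [h1, h2]
  · simp [h1]

theorem weight_inter_add_diff (w : V →₀ ℝ≥0) (S S' : Set V) :
    weight w (S ∩ S') + weight w (S \ S') = weight w S := by
  rw [← weight_union w (Set.disjoint_left.mpr fun i h h' => h'.2 h.2), Set.inter_union_sdiff]

theorem weight_union_le (w : V →₀ ℝ≥0) (S S' : Set V) :
    weight w (S ∪ S') ≤ weight w S + weight w S' := by
  have h := weight_union w (S := S) (S' := S' \ S) Set.disjoint_sdiff_right
  rw [Set.union_sdiff_self] at h
  have := weight_mono w (Set.sdiff_subset : S' \ S ⊆ S')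
  linarith

theorem exists_mem_of_weight_pos {w : V →₀ ℝ≥0} {S : Set V} (h : 0 < weight w S) : S.Nonempty := by
  by_contra hS
  rw [Set.not_nonempty_iff_eq_empty] at hS
  simp [weight, hS] at h

@[simp]
theorem weight_empty (w : V →₀ ℝ≥0) : weight w (∅ : Set V) = 0 := by
  simp [weight]

end Weight

namespace Protocol

variable {V B : Type*} (P : Protocol V B)

/-! ### The tree of blocks. -/

section Tree

theorem Anc.refl (b : B) : P.Anc b b := ⟨0, rfl⟩

variable {P}

theorem Anc.trans {a b c : B} (h : P.Anc a b) (h' : P.Anc b c) : P.Anc a c := by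
  obtain ⟨k, rfl⟩ := h
  obtain ⟨l, rfl⟩ := h'
  exact ⟨k + l, Function.iterate_add_apply _ _ _ _⟩

theorem anc_parent (b : B) : P.Anc (P.parent b) b := ⟨1, rfl⟩

theorem Anc.total {a b c : B} (h : P.Anc a c) (h' : P.Anc b c) : P.Anc a b ∨ P.Anc b a := by
  obtain ⟨k, rfl⟩ := h
  obtain ⟨l, rfl⟩ := h'
  rcases le_total k l with hkl | hkl
  · right
    exact ⟨l - k, by rw [← Function.iterate_add_apply, Nat.sub_add_cancel hkl]⟩
  · left
    exact ⟨k - l, by rw [← Function.iterate_add_apply, Nat.sub_add_cancel hkl]⟩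

theorem slot_parent_le (b : B) : P.slot (P.parent b) ≤ P.slot b := by
  by_cases h : b = P.gen
  · rw [h, P.parent_gen]
  · exact (P.slot_parent_lt b h).le

theorem Anc.eq_or_parent {a b : B} (h : P.Anc a b) : a = b ∨ b ≠ P.gen ∧ P.Anc a (P.parent b) := by
  obtain ⟨k, rfl⟩ := h
  cases k with
  | zero => exact Or.inl rfl
  | succ k =>
    by_cases hb : b = P.gen
    · subst hb
      exact Or.inl (Function.iterate_fixed P.parent_gen _)
    · exact Or.inr ⟨hb, k, rfl⟩

theorem Anc.slot_le {a b : B} (h : P.Anc a b) : P.slot a ≤ P.slot b := by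
  obtain ⟨k, rfl⟩ := h
  induction k generalizing b with
  | zero => exact le_rfl
  | succ k ih => exact ih.trans (slot_parent_le b)

theorem Anc.epoch_le {a b : B} (h : P.Anc a b) : P.epoch a ≤ P.epoch b :=
  Nat.div_le_div_right h.slot_le

theorem Anc.eq_of_slot_le {a b : B} (h : P.Anc a b) (hs : P.slot b ≤ P.slot a) : a = b := by
  rcases h.eq_or_parent with h | ⟨hb, h⟩
  · exact h
  · have := P.slot_parent_lt b hb
    have := h.slot_le
    omega

theorem Anc.antisymm {a b : B} (h : P.Anc a b) (h' : P.Anc b a) : a = b :=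
  h.eq_of_slot_le h'.slot_le

theorem anc_of_slot_le {a b c : B} (h : P.Anc a c) (h' : P.Anc b c) (hs : P.slot a ≤ P.slot b) :
    P.Anc a b := by
  rcases h.total h' with h1 | h1
  · exact h1
  · rw [h1.eq_of_slot_le hs]
    exact Anc.refl P a

theorem gen_anc (b : B) : P.Anc P.gen b := by
  induction hn : P.slot b using Nat.strong_induction_on generalizing b with
  | _ n ih =>
    by_cases hb : b = P.gen
    · exact ⟨0, hb⟩
    · exact (ih _ (hn ▸ P.slot_parent_lt b hb) _ rfl).trans (anc_parent b)

/-- The child of a proper ancestor on the way to a block. -/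
theorem Anc.exists_child {a b : B} (h : P.Anc a b) (hne : a ≠ b) :
    ∃ c, c ≠ P.gen ∧ P.parent c = a ∧ P.Anc c b := by
  obtain ⟨k, rfl⟩ := h
  induction k generalizing b with
  | zero => exact absurd rfl hne
  | succ k ih =>
    by_cases hk : P.parent^[k] (P.parent b) = P.parent b
    · refine ⟨b, ?_, ?_, Anc.refl P b⟩
      · rintro rfl
        exact hne (Function.iterate_fixed P.parent_gen _)
      · exact hk.symm
    · obtain ⟨c, hc, hp, hcb⟩ := ih hk
      exact ⟨c, hc, hp, hcb.trans (anc_parent b)⟩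

theorem parent_anc_of_ne {a b : B} (h : P.Anc a b) (hne : a ≠ b) : P.Anc a (P.parent b) := by
  rcases h.eq_or_parent with h | h
  · exact absurd h hne
  · exact h.2

/-- Following parents until a property holds yields the last block of the chain with the
property. -/
theorem iterate_sInf_spec {p : B → Prop} {b : B} (h : ∃ a, P.Anc a b ∧ p a) :
    P.Anc (P.parent^[sInf {k | p (P.parent^[k] b)}] b) b ∧
      p (P.parent^[sInf {k | p (P.parent^[k] b)}] b) ∧
      ∀ a, P.Anc a b → p a → P.Anc a (P.parent^[sInf {k | p (P.parent^[k] b)}] b) := by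
  have hne : {k | p (P.parent^[k] b)}.Nonempty := by
    obtain ⟨a, ⟨k, rfl⟩, hk⟩ := h
    exact ⟨k, hk⟩
  refine ⟨⟨_, rfl⟩, Nat.sInf_mem hne, ?_⟩
  rintro a ⟨k, rfl⟩ hk
  have hle : sInf {k | p (P.parent^[k] b)} ≤ k := Nat.sInf_le hk
  exact ⟨k - sInf {k | p (P.parent^[k] b)}, by
    rw [← Function.iterate_add_apply, Nat.sub_add_cancel hle]⟩

end Tree

/-! ### Slots, epochs and times. -/

section Slots

variable {P}

theorem slotsPerEpoch_pos : 0 < P.slotsPerEpoch := by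
  have := P.two_le_slotsPerEpoch
  omega

theorem firstSlot_strictMono : StrictMono P.firstSlot := fun _ _ h =>
  Nat.mul_lt_mul_of_pos_right h slotsPerEpoch_pos

theorem firstSlot_mono : Monotone P.firstSlot := firstSlot_strictMono.monotone

theorem firstSlot_le_iff {e s : ℕ} : P.firstSlot e ≤ s ↔ e ≤ P.epochOfSlot s :=
  (Nat.le_div_iff_mul_le slotsPerEpoch_pos).symm

theorem epochOfSlot_firstSlot (e : ℕ) : P.epochOfSlot (P.firstSlot e) = e :=
  Nat.mul_div_cancel e slotsPerEpoch_pos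

theorem epochOfSlot_eq_iff {e s : ℕ} :
    P.epochOfSlot s = e ↔ P.firstSlot e ≤ s ∧ s < P.firstSlot (e + 1) := by
  have h1 := firstSlot_le_iff (P := P) (e := e) (s := s)
  have h2 := firstSlot_le_iff (P := P) (e := e + 1) (s := s)
  omega

theorem epochOfSlot_lt_iff {e s : ℕ} : P.epochOfSlot s < e ↔ s < P.firstSlot e := by
  have h1 := firstSlot_le_iff (P := P) (e := e) (s := s)
  omega

theorem epoch_lt_iff {e : ℕ} {b : B} : P.epoch b < e ↔ P.slot b < P.firstSlot e :=
  epochOfSlot_lt_iff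

theorem le_epoch_iff {e : ℕ} {b : B} : e ≤ P.epoch b ↔ P.firstSlot e ≤ P.slot b :=
  firstSlot_le_iff.symm

theorem epoch_le_epochAt {b : B} {t : Time} (h : P.slot b ≤ P.slotAt t) :
    P.epoch b ≤ P.epochAt t :=
  Nat.div_le_div_right h

theorem lastSlot_add_one (e : ℕ) : P.lastSlot e + 1 = P.firstSlot (e + 1) := by
  have : 0 < (e + 1) * P.slotsPerEpoch := Nat.mul_pos e.succ_pos slotsPerEpoch_pos
  unfold lastSlot firstSlot
  omega

theorem slotAt_slotStart (s : ℕ) : P.slotAt (P.slotStart s) = s := by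
  apply le_antisymm
  · exact P.slotStart_strictMono.le_iff_le.mp ((P.slotStart_le_iff _ _).mpr le_rfl)
  · exact (P.slotStart_le_iff _ _).mp le_rfl

theorem slotStart_slotAt_le (t : Time) : P.slotStart (P.slotAt t) ≤ t :=
  (P.slotStart_le_iff _ _).mpr le_rfl

theorem lt_slotStart {t : Time} {s : ℕ} (h : P.slotAt t < s) : t < P.slotStart s := by
  by_contra hc
  have := (P.slotStart_le_iff s t).mp (not_lt.mp hc)
  omega

theorem slotAt_mono {t t' : Time} (h : t ≤ t') : P.slotAt t ≤ P.slotAt t' :=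
  (P.slotStart_le_iff _ _).mp ((slotStart_slotAt_le t).trans h)

theorem epochAt_mono {t t' : Time} (h : t ≤ t') : P.epochAt t ≤ P.epochAt t' :=
  Nat.div_le_div_right (slotAt_mono h)

theorem epochAt_slotStart (s : ℕ) : P.epochAt (P.slotStart s) = P.epochOfSlot s := by
  rw [epochAt, slotAt_slotStart]

theorem epochStart_mono : Monotone P.epochStart := fun _ _ h =>
  P.slotStart_strictMono.monotone (firstSlot_mono h)

theorem epochStart_le_iff {e : ℕ} {t : Time} : P.epochStart e ≤ t ↔ e ≤ P.epochAt t := by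
  rw [epochStart, P.slotStart_le_iff, firstSlot_le_iff, epochAt]

theorem epochAt_eq_iff {e : ℕ} {t : Time} :
    P.epochAt t = e ↔ P.firstSlot e ≤ P.slotAt t ∧ P.slotAt t < P.firstSlot (e + 1) :=
  epochOfSlot_eq_iff

end Slots

/-! ### Checkpoints and voting sources. -/

section Checkpoints

theorem chkp_spec (b : B) (e : ℕ) :
    P.Anc (P.chkp b e).block b ∧ P.slot (P.chkp b e).block ≤ P.firstSlot e ∧
      ∀ a, P.Anc a b → P.slot a ≤ P.firstSlot e → P.Anc a (P.chkp b e).block :=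
  iterate_sInf_spec (p := fun a => P.slot a ≤ P.firstSlot e)
    ⟨P.gen, gen_anc b, by rw [P.slot_gen]; exact Nat.zero_le _⟩

@[simp]
theorem chkp_epoch (b : B) (e : ℕ) : (P.chkp b e).epoch = e := rfl

variable {P}

theorem chkp_block_eq {b x : B} {e : ℕ} (h : P.Anc x b) (hs : P.slot x ≤ P.firstSlot e)
    (hx : ∀ a, P.Anc a b → P.slot a ≤ P.firstSlot e → P.Anc a x) : (P.chkp b e).block = x := by
  obtain ⟨h1, h2, h3⟩ := P.chkp_spec b e
  exact (hx _ h1 h2).antisymm (h3 _ h hs)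

theorem chkp_eq_of_block_eq {b : B} {C : Checkpoint B} (h : (P.chkp b C.epoch).block = C.block) :
    P.chkp b C.epoch = C :=
  Checkpoint.ext h rfl

theorem ChkpAncBlock.anc {C : Checkpoint B} {b : B} (h : P.ChkpAncBlock C b) : P.Anc C.block b := by
  have := (P.chkp_spec b C.epoch).1
  rwa [show P.chkp b C.epoch = C from h] at this

theorem ChkpAncBlock.slot_le {C : Checkpoint B} {b : B} (h : P.ChkpAncBlock C b) :
    P.slot C.block ≤ P.firstSlot C.epoch := by
  have := (P.chkp_spec b C.epoch).2.1
  rwa [show P.chkp b C.epoch = C from h] at this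

theorem ChkpAncBlock.anc_of_slot_le {C : Checkpoint B} {a b : B} (h : P.ChkpAncBlock C b)
    (ha : P.Anc a b) (hs : P.slot a ≤ P.firstSlot C.epoch) : P.Anc a C.block := by
  have := (P.chkp_spec b C.epoch).2.2 a ha hs
  rwa [show P.chkp b C.epoch = C from h] at this

theorem chkpAncBlock_chkp (b : B) (e : ℕ) : P.ChkpAncBlock (P.chkp b e) b := rfl

/-- The checkpoint of a chain does not change once the chain has reached the epoch. -/
theorem chkp_eq_of_anc {b b' : B} {e : ℕ} (h : P.Anc b b') (hs : P.firstSlot e ≤ P.slot b) :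
    P.chkp b' e = P.chkp b e := by
  obtain ⟨h1, h2, h3⟩ := P.chkp_spec b e
  refine Checkpoint.ext (chkp_block_eq (h1.trans h) h2 fun a ha has => ?_) rfl
  exact h3 a (anc_of_slot_le ha h (has.trans hs)) has

/-- A checkpoint of a chain is a checkpoint of each prefix that contains its block. -/
theorem ChkpAncBlock.of_anc {C : Checkpoint B} {a b : B} (h : P.ChkpAncBlock C b)
    (ha : P.Anc a b) (hC : P.Anc C.block a) : P.ChkpAncBlock C a :=
  chkp_eq_of_block_eq <| chkp_block_eq hC h.slot_le fun _ hx hs => h.anc_of_slot_le (hx.trans ha) hs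

/-- The block of the earlier checkpoint has slot at most that of `firstSlot e'`, so it stays on the
chain when `b` is cut at the later checkpoint. Transitivity of the order on checkpoints comes from
this. -/
theorem chkp_chkp_block {b : B} {e e' : ℕ} (h : e ≤ e') :
    P.chkp (P.chkp b e').block e = P.chkp b e := by
  have h1 := P.chkp_spec b e
  have h2 := P.chkp_spec b e'
  have h3 : P.Anc (P.chkp b e).block (P.chkp b e').block :=
    h2.2.2 _ h1.1 (h1.2.1.trans (firstSlot_mono h))
  exact ChkpAncBlock.of_anc (chkpAncBlock_chkp b e) h2.1 h3

theorem chkp_eq_self {b : B} {e : ℕ} (h : P.slot b ≤ P.firstSlot e) : P.chkp b e = ⟨b, e⟩ :=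
  Checkpoint.ext (chkp_block_eq (Anc.refl P b) h fun _ ha _ => ha) rfl

theorem ChkpAncBlock.trans {C C' : Checkpoint B} {b : B} (h : P.ChkpAnc C C')
    (h' : P.ChkpAncBlock C' b) : P.ChkpAncBlock C b := by
  rcases h with rfl | ⟨he, h⟩
  · exact h'
  · have h1 := chkp_chkp_block (P := P) (b := b) he.le
    rw [show P.chkp b C'.epoch = C' from h', show P.chkp C'.block C.epoch = C from h] at h1
    exact h1.symm

theorem greatest_mem {S : Set (Checkpoint B)} (h : ∃ C ∈ S, ∀ C' ∈ S, C'.epoch ≤ C.epoch) :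
    P.greatest S ∈ S ∧ ∀ C ∈ S, C.epoch ≤ (P.greatest S).epoch := by
  unfold greatest
  rw [dif_pos h]
  exact h.choose_spec

/-- This rules out the fallback value in `greatest`. The set may be infinite, but its epochs are
bounded. -/
theorem exists_greatest {S : Set (Checkpoint B)} (hS : S.Nonempty) {n : ℕ}
    (hn : ∀ C ∈ S, C.epoch ≤ n) : ∃ C ∈ S, ∀ C' ∈ S, C'.epoch ≤ C.epoch := by
  have hfin : (Checkpoint.epoch '' S).Finite :=
    (Set.finite_Iic n).subset (by rintro _ ⟨C, hC, rfl⟩; exact hn C hC)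
  obtain ⟨_, ⟨C, hC, rfl⟩, hmax⟩ := Set.exists_max_image _ id hfin (hS.image _)
  exact ⟨C, hC, fun C' hC' => hmax _ ⟨C', hC', rfl⟩⟩

theorem prevEpochBlock_spec {b : B} (h : 0 < P.epoch b) :
    P.Anc (P.prevEpochBlock b) b ∧ P.epoch (P.prevEpochBlock b) < P.epoch b ∧
      ∀ a, P.Anc a b → P.epoch a < P.epoch b → P.Anc a (P.prevEpochBlock b) := by
  refine iterate_sInf_spec (p := fun a => P.epoch a < P.epoch b) ⟨P.gen, gen_anc b, ?_⟩
  rwa [epoch, P.slot_gen, epochOfSlot, Nat.zero_div]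

/-- The voting source is the greatest unrealized justified checkpoint of the last block of an
earlier epoch. -/
theorem votingSource_spec {b : B} {e : ℕ} (h : P.epoch b ≤ e) (he : 0 < e) :
    ∃ x, P.Anc x b ∧ P.epoch x < e ∧ (∀ a, P.Anc a b → P.epoch a < e → P.Anc a x) ∧
      P.votingSource b e = P.gu x := by
  by_cases hb : P.epoch b < e
  · exact ⟨b, Anc.refl P b, hb, fun a ha _ => ha, if_pos hb⟩
  · obtain rfl : P.epoch b = e := by omega
    obtain ⟨h1, h2, h3⟩ := prevEpochBlock_spec he
    refine ⟨_, h1, h2, h3, ?_⟩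
    rw [votingSource, if_neg hb, gj, if_neg he.ne']

/-- All blocks of a chain within one epoch share the last block before that epoch, which alone
determines the voting source. -/
theorem votingSource_eq_of_anc {b b' : B} {e : ℕ} (h : P.Anc b b') (hb : P.epoch b = e)
    (hb' : P.epoch b' = e) (he : 0 < e) : P.votingSource b' e = P.votingSource b e := by
  obtain ⟨x, h1, h2, h3, h4⟩ := votingSource_spec hb.le he
  obtain ⟨x', h1', h2', h3', h4'⟩ := votingSource_spec hb'.le he
  have hxb : P.Anc x' b := by
    rcases h1'.total h with hx | hx
    · exact hx
    · have := hx.epoch_le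
      omega
  rw [h4, h4', (h3 _ hxb h2').antisymm (h3' _ (h1.trans h) h2)]

end Checkpoints

end Protocol

/-! ### Justified checkpoints along a chain. -/

namespace Execution

open Protocol

variable {V B : Type*} {P : Protocol V B} {X : Execution P}

namespace GasperProperties

variable {β d : ℝ} (hg : X.GasperProperties β d)

include hg

theorem gu_spec (b : B) : P.gu b ∈ P.justified b ∧ ∀ C ∈ P.justified b, C.epoch ≤ (P.gu b).epoch :=
  greatest_mem <| exists_greatest ⟨_, hg.justified_mono _ _ (gen_anc b) hg.gen_justified⟩
    (hg.justified_epoch_le b)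

theorem chkpAncBlock_gu (b : B) : P.ChkpAncBlock (P.gu b) b :=
  hg.justified_in_chain b _ (hg.gu_spec b).1

theorem chkpAncBlock_of_justified {C : Checkpoint B} {b b' : B} (hC : C ∈ P.justified b)
    (h : P.Anc b b') : P.ChkpAncBlock C b' :=
  hg.justified_in_chain _ _ (hg.justified_mono _ _ h hC)

theorem gu_epoch_mono {b b' : B} (h : P.Anc b b') : (P.gu b).epoch ≤ (P.gu b').epoch :=
  (hg.gu_spec b').2 _ (hg.justified_mono _ _ h (hg.gu_spec b).1)

theorem canBeJustified_votingSource {b : B} {e : ℕ} (h : P.epoch b ≤ e) (he : 0 < e) :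
    P.CanBeJustified (P.votingSource b e) ∧ (P.votingSource b e).epoch < e := by
  obtain ⟨x, -, h2, -, h4⟩ := votingSource_spec h he
  rw [h4]
  exact ⟨⟨x, (hg.gu_spec x).1⟩, (hg.justified_epoch_le x _ (hg.gu_spec x).1).trans_lt h2⟩

/-- The block that determines the voting source of `b'` is the last one before epoch `e`, so it
descends from `b`. This gives recent voting sources to all descendants of a block. -/
theorem gu_epoch_le_votingSource {b b' : B} {e : ℕ} (h : P.Anc b b') (hb : P.epoch b < e)
    (hb' : P.epoch b' ≤ e) : (P.gu b).epoch ≤ (P.votingSource b' e).epoch := by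
  obtain ⟨x, -, -, h3, h4⟩ := votingSource_spec hb' (Nat.zero_lt_of_lt hb)
  rw [h4]
  exact hg.gu_epoch_mono (h3 _ h hb)

theorem slot_block_le {C : Checkpoint B} (hC : P.CanBeJustified C) :
    P.slot C.block ≤ P.firstSlot C.epoch := by
  obtain ⟨b, hb⟩ := hC
  exact (hg.justified_in_chain b C hb).slot_le

end GasperProperties

end Execution

namespace Protocol

variable {V B : Type*} {P : Protocol V B}

/-! ### The walk of GHOST through the tree. -/

section Ghost

variable {tie : Set B → B} {w : V →₀ ℝ≥0} {x : Option B} {M : Set (Message V B)} {t : Time}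

theorem ghostStep_eq_of_children_eq_empty {b : B} (h : P.children M t b = ∅) :
    P.ghostStep tie w x M t b = b := by
  rw [ghostStep, if_neg (by rw [h]; exact Set.not_nonempty_empty)]

theorem ghostStep_mem (htie : ∀ S : Set B, S.Nonempty → tie S ∈ S) (hM : (blocksOf M).Finite)
    {b : B} (h : (P.children M t b).Nonempty) :
    P.ghostStep tie w x M t b ∈ P.children M t b ∧ ∀ c ∈ P.children M t b,
      P.ghostWeight w x M c ≤ P.ghostWeight w x M (P.ghostStep tie w x M t b) := by
  rw [ghostStep, if_pos h]
  refine htie {c | c ∈ P.children M t b ∧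
      ∀ c' ∈ P.children M t b, P.ghostWeight w x M c' ≤ P.ghostWeight w x M c} ?_
  obtain ⟨c, hc, hmax⟩ := Set.exists_max_image _ (P.ghostWeight w x M)
    (hM.subset fun c (hc : c ∈ P.children M t b) => hc.1) h
  exact ⟨c, hc, hmax⟩

theorem anc_ghost_mem (htie : ∀ S : Set B, S.Nonempty → tie S ∈ S) (hM : (blocksOf M).Finite)
    {a : B} (h : P.Anc a (P.ghost tie w x M t)) :
    P.slot a ≤ P.slotAt t ∧ (a = P.gen ∨ a ∈ blocksOf M) := by
  unfold ghost at h
  generalize P.slotAt t + 1 = n at h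
  induction n with
  | zero =>
    obtain rfl : a = P.gen := h.antisymm (gen_anc a)
    exact ⟨by rw [P.slot_gen]; exact Nat.zero_le _, Or.inl rfl⟩
  | succ n ih =>
    rw [Function.iterate_succ_apply'] at h
    set b := (P.ghostStep tie w x M t)^[n] P.gen
    rcases Set.eq_empty_or_nonempty (P.children M t b) with he | hne
    · rw [ghostStep_eq_of_children_eq_empty he] at h
      exact ih h
    · have hc := (ghostStep_mem (w := w) (x := x) htie hM hne).1
      rcases h.eq_or_parent with rfl | ⟨-, h⟩
      · exact ⟨hc.2.2.2, Or.inr hc.1⟩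
      · rw [hc.2.2.1] at h
        exact ih h

theorem anc_ghost (htie : ∀ S : Set B, S.Nonempty → tie S ∈ S) (hM : (blocksOf M).Finite) {b : B}
    (h : ∀ c, c ≠ P.gen → P.Anc c b → c ∈ P.children M t (P.parent c) ∧
      ∀ c' ∈ P.children M t (P.parent c), c' ≠ c →
        P.ghostWeight w x M c' < P.ghostWeight w x M c) :
    P.Anc b (P.ghost tie w x M t) := by
  -- Each step below `b` raises the slot by at least one, so after `slotAt t + 1` steps the walk
  -- cannot still be strictly below `b`.
  have key : ∀ n, P.Anc b ((P.ghostStep tie w x M t)^[n] P.gen) ∨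
      P.Anc ((P.ghostStep tie w x M t)^[n] P.gen) b ∧
        n ≤ P.slot ((P.ghostStep tie w x M t)^[n] P.gen) := by
    intro n
    induction n with
    | zero => exact Or.inr ⟨gen_anc b, Nat.zero_le _⟩
    | succ n ih =>
      rw [Function.iterate_succ_apply']
      generalize (P.ghostStep tie w x M t)^[n] P.gen = a at ih ⊢
      by_cases hba : P.Anc b a
      · left
        rcases Set.eq_empty_or_nonempty (P.children M t a) with he | hne
        · rwa [ghostStep_eq_of_children_eq_empty he]
        · have hc := (ghostStep_mem (w := w) (x := x) htie hM hne).1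
          have := anc_parent (P := P) (P.ghostStep tie w x M t a)
          rw [hc.2.2.1] at this
          exact hba.trans this
      · right
        obtain ⟨hab, hn⟩ := ih.resolve_left hba
        obtain ⟨c, hcg, rfl, hcb⟩ := hab.exists_child fun hab' => hba (hab' ▸ Anc.refl P _)
        obtain ⟨hc, hmax⟩ := h c hcg hcb
        obtain ⟨hs, hsmax⟩ := ghostStep_mem (w := w) (x := x) htie hM ⟨c, hc⟩
        -- The strict inequality makes `c` the only heaviest child, so the tie-breaking rule plays
        -- no role.
        have heq : P.ghostStep tie w x M t (P.parent c) = c := by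
          by_contra hne
          exact absurd (hsmax c hc) (not_le.mpr (hmax _ hs hne))
        rw [heq]
        exact ⟨hcb, hn.trans_lt (P.slot_parent_lt c hcg)⟩
  rcases key (P.slotAt t + 1) with hk | ⟨hk, hn⟩
  · exact hk
  · exfalso
    have hb : P.slot b ≤ P.slotAt t := by
      by_cases hbg : b = P.gen
      · rw [hbg, P.slot_gen]
        exact Nat.zero_le _
      · exact (h b hbg (Anc.refl P b)).1.2.2.2
    have := hk.slot_le
    omega

end Ghost

/-! ### The filters on votes and blocks. -/

section Filters

variable {K : ℕ → Finset V} {M : Set (Message V B)} {t : Time}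

/-- The GHOST votes that pass all the filters of LMD-GHOST but the last. -/
def Countable (P : Protocol V B) (K : ℕ → Finset V) (M : Set (Message V B)) (t : Time)
    (a : GhostVote V B) : Prop :=
  a ∈ ghostsOf M ∧
    (¬ ∃ a₁ ∈ ghostsOf M, ∃ a₂ ∈ ghostsOf M,
      a₁.signer = a.signer ∧ a₂.signer = a.signer ∧ a₁.slot = a₂.slot ∧ a₁.block ≠ a₂.block) ∧
    a.slot < P.slotAt t ∧ a.signer ∈ K a.slot ∧ P.slot a.block ≤ a.slot

theorem mem_ghostsOf_filInv {a : GhostVote V B} :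
    a ∈ ghostsOf (P.filInv K (P.filCur (filEq M) t)) ↔ P.Countable K M t a := by
  have h1 : a ∈ ghostsOf (filEq M) ↔ a ∈ ghostsOf M ∧
      ¬ ∃ a₁ ∈ ghostsOf M, ∃ a₂ ∈ ghostsOf M,
        a₁.signer = a.signer ∧ a₂.signer = a.signer ∧ a₁.slot = a₂.slot ∧ a₁.block ≠ a₂.block := by
    refine and_congr_right fun _ => not_congr ⟨?_, fun h => ⟨a, rfl, h⟩⟩
    rintro ⟨a', h, h'⟩
    cases h
    exact h'
  have h2 : a ∈ ghostsOf (P.filCur (filEq M) t) ↔ a ∈ ghostsOf (filEq M) ∧ a.slot < P.slotAt t := by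
    refine and_congr_right fun _ => ⟨fun h => ?_, ?_⟩
    · by_contra hc
      exact h ⟨a, rfl, not_lt.mp hc⟩
    · rintro h ⟨a', h', hle⟩
      cases h'
      omega
  have h3 : a ∈ ghostsOf (P.filInv K (P.filCur (filEq M) t)) ↔
      a ∈ ghostsOf (P.filCur (filEq M) t) ∧ a.signer ∈ K a.slot ∧ P.slot a.block ≤ a.slot := by
    refine and_congr_right fun _ => ⟨fun h => ⟨?_, ?_⟩, ?_⟩
    · by_contra hc
      exact h ⟨a, rfl, Or.inl hc⟩
    · by_contra hc
      exact h ⟨a, rfl, Or.inr (not_le.mp hc)⟩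
    · rintro ⟨h, hs⟩ ⟨a', h', hle⟩
      cases h'
      rcases hle with hle | hle
      · exact hle h
      · omega
  rw [h3, h2, h1, Countable]
  tauto

theorem mem_ghostsOf_filLmdGhost {a : GhostVote V B} :
    a ∈ ghostsOf (P.filLmdGhost K M t) ↔ P.Countable K M t a ∧
      ∀ a₁, P.Countable K M t a₁ → a₁.signer = a.signer → a₁.slot ≤ a.slot := by
  rw [← mem_ghostsOf_filInv]
  refine and_congr_right fun _ => ⟨fun h a₁ h₁ hs => ?_, ?_⟩
  · by_contra hc
    exact h ⟨a, rfl, a₁, mem_ghostsOf_filInv.mpr h₁, hs, not_le.mp hc⟩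
  · rintro h ⟨a', h', a₁, h₁, hs, hlt⟩
    cases h'
    exact absurd (h a₁ (mem_ghostsOf_filInv.mp h₁) hs) (not_le.mpr hlt)

theorem mem_blocksOf_filLmdGhost {b : B} : b ∈ blocksOf (P.filLmdGhost K M t) ↔ b ∈ blocksOf M := by
  simp [blocksOf, filLmdGhost, filLmd, filInv, filCur, filEq]

theorem mem_blocksOf_filHfc {b : B} :
    b ∈ blocksOf (P.filHfc M t) ↔ b ∈ blocksOf M ∧ P.KeptByHFC M t b := by
  simp [blocksOf, filHfc]

theorem ghostsOf_filHfc : ghostsOf (P.filHfc M t) = ghostsOf M := by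
  ext a
  simp [ghostsOf, filHfc]

/-- The FFG filter removes blocks only. Support measured on the unfiltered view by the confirmation
rule is thus the support that the fork choice counts. -/
theorem ghostVoters_filHfc (b : B) :
    P.ghostVoters (P.filLmdGhost K (P.filHfc M t) t) b =
      P.ghostVoters (P.filLmdGhost K M t) b := by
  have h : ∀ a, a ∈ ghostsOf (P.filLmdGhost K (P.filHfc M t) t) ↔
      a ∈ ghostsOf (P.filLmdGhost K M t) := fun a => by
    simp only [mem_ghostsOf_filLmdGhost, Countable, ghostsOf_filHfc]
  ext i
  simp only [ghostVoters, h, Set.mem_ofPred_eq]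

/-- Each validator supports at most one of two conflicting blocks. -/
theorem disjoint_ghostVoters {b c : B} (h : ∀ x, P.Anc b x → ¬ P.Anc c x) :
    Disjoint (P.ghostVoters (P.filLmdGhost K M t) b) (P.ghostVoters (P.filLmdGhost K M t) c) := by
  rw [Set.disjoint_left]
  rintro i ⟨a, ha, rfl, hab⟩ ⟨a', ha', hs, hac⟩
  rw [mem_ghostsOf_filLmdGhost] at ha ha'
  have h1 := ha.2 a' ha'.1 hs
  have h2 := ha'.2 a ha.1 hs.symm
  refine h a.block hab ?_
  by_contra hne
  refine ha.1.2.1 ⟨a, ha.1.1, a', ha'.1.1, rfl, hs, le_antisymm h2 h1, ?_⟩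
  intro heq
  exact hne (heq ▸ hac)

end Filters

end Protocol

/-! ### Message delivery and honest votes. -/

namespace Execution

open Protocol

variable {V B : Type*} {P : Protocol V B} {X : Execution P}

theorem sent_mono {t t' : Time} (h : t ≤ t') : X.sent t ⊆ X.sent t' := by
  rintro m ⟨i, s, hs, hm⟩
  exact ⟨i, s, hs.trans h, hm⟩

/-- Slot `k` is the last slot before slot `n` for which `i` cast a GHOST vote that is valid
according to the committees `K`. -/
def LatestVote (X : Execution P) (K : ℕ → Finset V) (i : V) (n k : ℕ) : Prop :=
  (k < n ∧ X.VotesIn i k ∧ i ∈ K k) ∧ ∀ k' < n, X.VotesIn i k' → i ∈ K k' → k' ≤ k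

/-- The honest validators whose latest valid GHOST votes before slot `n` support `b`. -/
def honestSupport (X : Execution P) (K : ℕ → Finset V) (n : ℕ) (b : B) : Set V :=
  {i | i ∈ X.honest ∧ ∃ k, X.LatestVote K i n k ∧ P.Anc b (X.forkChoice i (X.voteTime i k))}

theorem exists_latestVote {K : ℕ → Finset V} {i : V} {n k : ℕ} (hk : k < n) (hv : X.VotesIn i k)
    (hK : i ∈ K k) : ∃ k', k ≤ k' ∧ X.LatestVote K i n k' := by
  have hfin : {k | k < n ∧ X.VotesIn i k ∧ i ∈ K k}.Finite :=
    (Set.finite_Iio n).subset fun k hk => hk.1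
  obtain ⟨k', hk', hmax⟩ := Set.exists_max_image _ id hfin ⟨k, hk, hv, hK⟩
  exact ⟨k', hmax k ⟨hk, hv, hK⟩, hk', fun l hl hlv hlK => hmax l ⟨hl, hlv, hlK⟩⟩

theorem committees_mono {v : V} {t : Time} {s₁ s₂ s₁' s₂' : ℕ} (h : s₂ ≤ s₁) (h' : s₁' ≤ s₂') :
    X.committees v t s₁ s₁' ⊆ X.committees v t s₂ s₂' := by
  rintro i ⟨k, h1, h2, hk⟩
  exact ⟨k, h.trans h1, h2.trans_le h', hk⟩

namespace FollowsProtocol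

variable (hr : X.FollowsProtocol) {v : V} (hv : v ∈ X.honest)

include hr hv

theorem view_subset_sent (t : Time) : X.view v t ⊆ X.sent t := fun m hm =>
  let ⟨t', ht', h⟩ := hr.gossip v hv t m hm
  ⟨v, t', ht', h⟩

theorem blocksOf_view_finite (t : Time) : (blocksOf (X.view v t)).Finite :=
  (hr.view_finite v hv t).preimage fun _ _ _ _ h => Message.block.inj h

theorem slotStart_le_voteTime (s : ℕ) : P.slotStart s ≤ X.voteTime v s :=
  (P.slotStart_le_iff _ _).mpr (hr.voteTime_slot v hv s).ge

theorem slotStart_add_Δ_lt (s : ℕ) : P.slotStart s + X.Δ < P.slotStart (s + 1) :=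
  (add_le_add_left (hr.slotStart_le_voteTime hv s) _).trans_lt (hr.voteTime_lt v hv s)

theorem voteTime_add_Δ_le {k s : ℕ} (h : k < s) : X.voteTime v k + X.Δ ≤ P.slotStart s :=
  (hr.voteTime_lt v hv k).le.trans (P.slotStart_strictMono.monotone h)

/-- Every slot is longer than `Δ`, because votes cast in it arrive before its end. Both cases in the
definition of `GGST` leave at least one full slot after `GST`. -/
theorem GST_add_Δ_le : X.GST + X.Δ ≤ X.ggst := by
  unfold ggst Protocol.ggst
  split_ifs with h
  · calc X.GST + X.Δ ≤ P.slotStart (P.lastSlot (P.epochAt X.GST)) + X.Δ := add_le_add_left h _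
      _ ≤ P.slotStart (P.lastSlot (P.epochAt X.GST) + 1) := (hr.slotStart_add_Δ_lt hv _).le
      _ = _ := by rw [lastSlot_add_one, epochStart]
  · have h1 : X.GST ≤ P.slotStart (P.firstSlot (P.epochAt X.GST + 1)) :=
      (lt_slotStart (epochAt_eq_iff.mp rfl).2).le
    calc X.GST + X.Δ ≤ P.slotStart (P.firstSlot (P.epochAt X.GST + 1)) + X.Δ :=
          add_le_add_left h1 _
      _ ≤ P.slotStart (P.firstSlot (P.epochAt X.GST + 1) + 1) := (hr.slotStart_add_Δ_lt hv _).le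
      _ ≤ _ := P.slotStart_strictMono.monotone (firstSlot_strictMono (Nat.lt_succ_self _))

theorem mem_view_of_broadcast {i : V} (hi : i ∈ X.honest) {m : Message V B} {t t' : Time}
    (hm : m ∈ X.broadcast i t) (ht : t + X.Δ ≤ t') (hg : X.ggst ≤ t') : m ∈ X.view v t' := by
  refine hr.view_mono v hv _ _ ?_ (hr.delivery i hi t m hm v hv)
  rcases max_cases t X.GST with ⟨h, -⟩ | ⟨h, -⟩
  · rwa [h]
  · rw [h]
    exact (hr.GST_add_Δ_le hv).trans hg

theorem mem_view_of_mem_view {i : V} (hi : i ∈ X.honest) {m : Message V B} {t t' : Time}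
    (hm : m ∈ X.view i t) (ht : t + X.Δ ≤ t') (hg : X.ggst ≤ t') : m ∈ X.view v t' := by
  obtain ⟨s, hs, h⟩ := hr.gossip i hi t m hm
  exact hr.mem_view_of_broadcast hv hi h ((add_le_add_left hs _).trans ht) hg

theorem anc_forkChoice {a : B} {t : Time} (h : P.Anc a (X.forkChoice v t)) :
    P.slot a ≤ P.slotAt t ∧ a ∈ blocksOf (X.view v t) := by
  have hM : (blocksOf (P.filLmdGhost (X.committee v t) (P.filHfc (X.view v t) t) t)).Finite :=
    (hr.blocksOf_view_finite hv t).subset fun b hb =>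
      (mem_blocksOf_filHfc.mp (mem_blocksOf_filLmdGhost.mp hb)).1
  obtain ⟨h1, h2⟩ := anc_ghost_mem hr.tie_mem hM h
  refine ⟨h1, ?_⟩
  rcases h2 with rfl | h2
  · exact hr.gen_mem_view v hv t
  · exact (mem_blocksOf_filHfc.mp (mem_blocksOf_filLmdGhost.mp h2)).1

/-- A block on the canonical chain of a voter is received by everybody before the next slot. -/
theorem mem_view_of_anc_forkChoice {i : V} (hi : i ∈ X.honest) {a : B} {k : ℕ} {t : Time}
    (h : P.Anc a (X.forkChoice i (X.voteTime i k))) (hk : k < P.slotAt t) (hg : X.ggst ≤ t) :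
    a ∈ blocksOf (X.view v t) :=
  hr.mem_view_of_mem_view hv hi (hr.anc_forkChoice hi h).2
    ((hr.voteTime_add_Δ_le hi hk).trans (slotStart_slotAt_le t)) hg

theorem slot_le_of_anc_voteTime {a : B} {k : ℕ}
    (h : P.Anc a (X.forkChoice v (X.voteTime v k))) : P.slot a ≤ k := by
  have := (hr.anc_forkChoice hv h).1
  rwa [hr.voteTime_slot v hv] at this

/-- Agreement on committees covers the voter's own view only from `GGST` on. For earlier slots, a
validator may vote without belonging to the committee seen later, which is why `LatestVote` records
both conditions. -/
theorem votesIn_of_mem_committee {i : V} (hi : i ∈ X.honest) {k : ℕ} {t : Time} (ht : X.ggst ≤ t)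
    (hk : X.ggst ≤ P.slotStart k) (h : i ∈ X.committee v t k) : X.VotesIn i k := by
  rw [VotesIn, hr.committee_agree i hi v hv _ t (hk.trans (hr.slotStart_le_voteTime hi k)) ht]
  exact h

theorem mem_committee_of_votesIn {i : V} (hi : i ∈ X.honest) {k : ℕ} {t : Time} (ht : X.ggst ≤ t)
    (hk : X.ggst ≤ P.slotStart k) (h : X.VotesIn i k) : i ∈ X.committee v t k := by
  rwa [VotesIn, hr.committee_agree i hi v hv _ t (hk.trans (hr.slotStart_le_voteTime hi k)) ht] at h

/-- An honest vote from a past slot has arrived, does not equivocate and is for a block that is not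
newer than it, so only the committee test can reject it. The right-hand side does not mention the
view, so honest observers who agree on the committees count the same honest votes. -/
theorem countable_iff {i : V} (hi : i ∈ X.honest) {t : Time} (ht : X.ggst ≤ t)
    {K : ℕ → Finset V} {a : GhostVote V B} (ha : a.signer = i) :
    P.Countable K (X.view v t) t a ↔
      ∃ k < P.slotAt t, X.VotesIn i k ∧ i ∈ K k ∧ a = X.ghostVote i k := by
  have hun : ∀ a ∈ ghostsOf (X.view v t), a.signer = i →
      ∃ k, X.VotesIn i k ∧ a = X.ghostVote i k := by
    rintro a hm rfl
    obtain ⟨k, h1, -, h2⟩ := hr.ghost_unforgeable t a (hr.view_subset_sent hv t hm) hi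
    exact ⟨k, h1, h2⟩
  constructor
  · rintro ⟨h1, -, h3, h4, -⟩
    obtain ⟨k, hk, rfl⟩ := hun a h1 ha
    exact ⟨k, h3, hk, h4, rfl⟩
  · rintro ⟨k, hk, hvk, hK, rfl⟩
    refine ⟨hr.mem_view_of_broadcast hv hi (hr.casts_ghost i hi k hvk)
      ((hr.voteTime_add_Δ_le hi hk).trans (slotStart_slotAt_le t)) ht, ?_, hk, hK,
      hr.slot_le_of_anc_voteTime hi (Anc.refl P _)⟩
    rintro ⟨a₁, h1, a₂, h2, hs1, hs2, hs, hne⟩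
    obtain ⟨k₁, -, rfl⟩ := hun a₁ h1 hs1
    obtain ⟨k₂, -, rfl⟩ := hun a₂ h2 hs2
    obtain rfl : k₁ = k₂ := hs
    exact hne rfl

theorem ghostVoters_inter_honest {t : Time} (ht : X.ggst ≤ t) (K : ℕ → Finset V) (b : B) :
    P.ghostVoters (P.filLmdGhost K (X.view v t) t) b ∩ X.honest =
      X.honestSupport K (P.slotAt t) b := by
  ext i
  constructor
  · rintro ⟨⟨a, ha, hs, hab⟩, hi⟩
    obtain ⟨h1, h2⟩ := mem_ghostsOf_filLmdGhost.mp ha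
    obtain ⟨k, hk, hvk, hK, rfl⟩ := (hr.countable_iff hv hi ht hs).mp h1
    refine ⟨hi, k, ⟨⟨hk, hvk, hK⟩, fun k' hk' hvk' hK' => ?_⟩, hab⟩
    exact h2 (X.ghostVote i k') ((hr.countable_iff hv hi ht rfl).mpr ⟨k', hk', hvk', hK', rfl⟩) rfl
  · rintro ⟨hi, k, ⟨⟨hk, hvk, hK⟩, hmax⟩, hb⟩
    refine ⟨⟨X.ghostVote i k, mem_ghostsOf_filLmdGhost.mpr
      ⟨(hr.countable_iff hv hi ht rfl).mpr ⟨k, hk, hvk, hK, rfl⟩, fun a ha hs => ?_⟩, rfl, hb⟩, hi⟩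
    obtain ⟨k', hk', hvk', hK', rfl⟩ := (hr.countable_iff hv hi ht hs).mp ha
    exact hmax k' hk' hvk' hK'

end FollowsProtocol

end Execution

/-! ### The LMD-GHOST margin and canonicity. -/

namespace Execution

open Protocol

variable {V B : Type*} {P : Protocol V B} {X : Execution P}

/-- The weight of the honest validators in a set; it is the same for all blocks. -/
noncomputable def honestWeight (X : Execution P) (S : Set V) : ℝ :=
  weight (P.eba P.gen) (S ∩ X.honest)

/-- The assumptions under which `isConfirmed` is a confirmation rule. -/
structure Assumptions (X : Execution P) (β d : ℝ) (W : ℝ≥0∞) : Prop where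
  run : X.FollowsProtocol
  gasper : X.GasperProperties β d
  fixed : X.FixedValidatorSet
  beta : X.BetaBound β
  slash : X.SlashingBound W
  strong : X.StrongJustification β
  lt_sixth : β < 1 / 6
  lt_third : β < 1 / 3 - d

theorem honestWeight_nonneg (S : Set V) : 0 ≤ X.honestWeight S := weight_nonneg _ _

theorem honestWeight_mono {S S' : Set V} (h : S ⊆ S') : X.honestWeight S ≤ X.honestWeight S' :=
  weight_mono _ (Set.inter_subset_inter_left _ h)

theorem boostWeight_nonneg (w : V →₀ ℝ≥0) : 0 ≤ P.boostWeight w :=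
  mul_nonneg (div_nonneg P.boostScore.coe_nonneg (Nat.cast_nonneg _)) (weight_nonneg _ _)

theorem boostWeight_mono {w w' : V →₀ ℝ≥0} (h : totalWeight w ≤ totalWeight w') :
    P.boostWeight w ≤ P.boostWeight w' :=
  mul_le_mul_of_nonneg_left h (div_nonneg P.boostScore.coe_nonneg (Nat.cast_nonneg _))

theorem weight_eq_of_forall {w w' : V →₀ ℝ≥0} {S : Set V} (h : ∀ i ∈ S, w i = w' i) :
    weight w S = weight w' S :=
  le_antisymm (weight_le_weight fun i hi _ => ⟨hi, (h i hi).le⟩)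
    (weight_le_weight fun i hi _ => ⟨hi, (h i hi).ge⟩)

namespace Assumptions

variable {β d : ℝ} {W : ℝ≥0∞} (hA : X.Assumptions β d W)

include hA

theorem weight_anti {a b : B} (h : P.Anc a b) (S : Set V) :
    weight (P.eba b) S ≤ weight (P.eba a) S :=
  weight_le_weight fun i hi _ => ⟨hi, hA.fixed.eba_anti a b h i⟩

/-- Balances change along a chain only for slashed validators, and honest ones are never slashed. -/
theorem weight_inter_honest (b : B) (S : Set V) :
    weight (P.eba b) (S ∩ X.honest) = X.honestWeight S :=
  weight_eq_of_forall fun i hi =>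
    hA.fixed.eba_eq _ _ (gen_anc b) i (hA.run.honest_not_slashed i hi.2 b)

theorem honestWeight_le (b : B) (S : Set V) : X.honestWeight S ≤ weight (P.eba b) S := by
  rw [← hA.weight_inter_honest b]
  exact weight_mono _ Set.inter_subset_left

variable {v : V} (hv : v ∈ X.honest)

include hv

/-- The bound for the genesis checkpoint extends to any block: balances on the left only decrease
along the chain, while the honest weight on the right stays the same. -/
theorem beta_bound {t : Time} (ht : X.ggst ≤ t) (s s' : ℕ) (b : B) :
    (1 - β) * weight (P.eba b) (X.committees v t s s') ≤
      X.honestWeight (X.committees v t s s') := by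
  have h1 := hA.beta.2 v hv t ht s s' P.gen P.genChkp hA.gasper.gen_justified
  have h2 := hA.weight_anti (gen_anc b) (X.committees v t s s')
  have h3 : 0 ≤ 1 - β := by
    have := hA.lt_sixth
    linarith
  exact (mul_le_mul_of_nonneg_left h2 h3).trans h1

/-- The committees of epoch `0` contain every validator with a positive balance, so their range has
the total weight. -/
theorem beta_bound_total (b : B) :
    (1 - β) * totalWeight (P.eba b) ≤ X.honestWeight Set.univ := by
  have h1 := hA.beta_bound hv le_rfl (P.firstSlot 0) (P.firstSlot (0 + 1)) b
  have h2 : totalWeight (P.eba b) ≤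
      weight (P.eba b) (X.committees v X.ggst (P.firstSlot 0) (P.firstSlot (0 + 1))) := by
    refine weight_le_weight fun i _ hi => ⟨?_, le_rfl⟩
    have := hA.run.validatorSet_gen v hv X.ggst le_rfl
    rw [validatorSet] at this
    rw [this]
    exact hi.trans_le (hA.fixed.eba_anti _ _ (gen_anc b) i)
  have h3 : 0 ≤ 1 - β := by
    have := hA.lt_sixth
    linarith
  exact (mul_le_mul_of_nonneg_left h2 h3).trans
    (h1.trans (honestWeight_mono (Set.subset_univ _)))

/-- LMD-GHOST safety yields a margin that depends on honest votes only. -/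
theorem honestSupport_margin {s : ℕ} (hs : X.ggst ≤ P.slotStart s) {b c : B} {C : Checkpoint B}
    (hsafe : X.isLMDGHOSTSafe β v b C (P.slotStart s)) (hc : P.Anc c b) (hne : c ≠ P.gen) :
    X.honestWeight (X.blockCommittees v (P.slotStart s) c) +
        (1 - β) * P.boostWeight (P.eba C.block) <
      2 * (1 - β) * X.honestWeight (X.honestSupport (X.committee v (P.slotStart s)) s c ∩
        X.blockCommittees v (P.slotStart s) c) := by
  have h := (hsafe c hc).resolve_left hne
  have hH : X.support v (P.slotStart s) c ∩ X.honest =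
      X.honestSupport (X.committee v (P.slotStart s)) s c ∩
        X.blockCommittees v (P.slotStart s) c := by
    have := hA.run.ghostVoters_inter_honest hv hs (X.committee v (P.slotStart s)) c
    rw [slotAt_slotStart] at this
    rw [support, ← this]
    exact Set.inter_right_comm _ _ _
  have hAle := hA.beta_bound hv hs (P.slot (P.parent c) + 1) (P.slotAt (P.slotStart s)) C.block
  rw [← blockCommittees] at hAle
  have hsup : X.support v (P.slotStart s) c ⊆ X.blockCommittees v (P.slotStart s) c :=
    Set.inter_subset_right
  rw [indicatorQ] at h
  set A := X.blockCommittees v (P.slotStart s) c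
  set S := X.support v (P.slotStart s) c
  set w := P.eba C.block
  have h1 : weight w (S ∩ X.honest) + weight w (S \ X.honest) = weight w S :=
    weight_inter_add_diff w S X.honest
  have h2 : weight w (A ∩ X.honest) + weight w (A \ X.honest) = weight w A :=
    weight_inter_add_diff w A X.honest
  -- In the worst case every Byzantine member of the committees supports `c`.
  have h3 : weight w (S \ X.honest) ≤ weight w (A \ X.honest) :=
    weight_mono w (Set.sdiff_subset_sdiff_left hsup)
  rw [← hH]
  have h4 : X.honestWeight (S ∩ X.honest) = weight w (S ∩ X.honest) := by
    rw [← hA.weight_inter_honest C.block, Set.inter_assoc, Set.inter_self]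
  have h5 : X.honestWeight A = weight w (A ∩ X.honest) := (hA.weight_inter_honest C.block A).symm
  rw [h4]
  rw [h5] at hAle ⊢
  have hβ := hA.beta.1
  have hβ' := hA.lt_sixth
  -- With zero committee weight both quotients are zero by convention, and the condition would read
  -- `1 / 2 + β < 0`.
  have hpos : 0 < weight w A := by
    refine lt_of_le_of_ne (weight_nonneg w A) fun h0 => ?_
    rw [← h0] at h
    simp only [div_zero] at h
    linarith
  rw [lt_div_iff₀ hpos] at h
  have h6 : (1 / 2 * (1 + P.boostWeight w / weight w A) + β) * weight w A =
      1 / 2 * weight w A + 1 / 2 * P.boostWeight w + β * weight w A := by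
    field_simp
  rw [h6] at h
  -- Doubling this and replacing `(1 - β) * weight w A` by the honest weight of `A`, with
  -- coefficient `1 - 2 * β`, leaves that honest weight with coefficient `2 * (1 - β) - (1 - 2 * β)
  -- = 1`.
  have h7 : 0 < (1 - β) * (weight w (S ∩ X.honest) - (weight w (A ∩ X.honest) -
      (1 / 2 - β) * weight w A + 1 / 2 * P.boostWeight w)) :=
    mul_pos (by linarith) (by linarith)
  have h8 : (1 - 2 * β) * ((1 - β) * weight w A) ≤ (1 - 2 * β) * weight w (A ∩ X.honest) :=
    mul_le_mul_of_nonneg_left hAle (by linarith)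
  linarith

/-- A positive margin forces some honest support. It serves to show that `c` has reached every
honest validator. -/
theorem exists_voter_of_isLMDGHOSTSafe {s : ℕ} (hs : X.ggst ≤ P.slotStart s) {b c : B}
    {C : Checkpoint B} (hsafe : X.isLMDGHOSTSafe β v b C (P.slotStart s)) (hc : P.Anc c b)
    (hne : c ≠ P.gen) :
    ∃ i ∈ X.honest, ∃ k < s, P.Anc c (X.forkChoice i (X.voteTime i k)) := by
  have h := hA.honestSupport_margin hv hs hsafe hc hne
  have hβ' := hA.lt_sixth
  have h1 := honestWeight_nonneg (X := X) (X.blockCommittees v (P.slotStart s) c)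
  have h2 : 0 ≤ (1 - β) * P.boostWeight (P.eba C.block) :=
    mul_nonneg (by linarith) (boostWeight_nonneg _)
  obtain ⟨i, ⟨⟨hi, k, hk, hb⟩, -⟩, -⟩ :=
    exists_mem_of_weight_pos (pos_of_mul_pos_right ((add_nonneg h1 h2).trans_lt h)
      (by linarith : 0 ≤ 2 * (1 - β)))
  exact ⟨i, hi, k, hk.1.1, hb⟩

/-- The margin persists while the honest validators keep voting for the block. -/
theorem ghostVoters_margin {s : ℕ} (hs : X.ggst ≤ P.slotStart s) {b c : B} {C : Checkpoint B}
    (hsafe : X.isLMDGHOSTSafe β v b C (P.slotStart s)) (hc : P.Anc c b) (hne : c ≠ P.gen)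
    {v' : V} (hv' : v' ∈ X.honest) {t : Time} (hst : s ≤ P.slotAt t)
    (hvotes : ∀ i ∈ X.honest, ∀ k, s ≤ k → k < P.slotAt t →
      P.Anc b (X.forkChoice i (X.voteTime i k)))
    {x : B} (hx : P.Anc C.block x) :
    weight (P.eba x) (X.blockCommittees v' t c) + P.boostWeight (P.eba x) <
      2 * weight (P.eba x)
        (P.ghostVoters (P.filLmdGhost (X.committee v' t) (X.view v' t) t) c) := by
  have hst' : P.slotStart s ≤ t := (P.slotStart_le_iff _ _).mpr hst
  have ht : X.ggst ≤ t := hs.trans hst'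
  have hK : X.committee v (P.slotStart s) = X.committee v' t :=
    hA.run.committee_agree v hv v' hv' _ _ hs ht
  have hm := hA.honestSupport_margin hv hs hsafe hc hne
  rw [hK] at hm
  have hH := hA.run.ghostVoters_inter_honest hv' ht (X.committee v' t) c
  set A := X.blockCommittees v (P.slotStart s) c
  set S := X.blockCommittees v' t c
  set G := P.ghostVoters (P.filLmdGhost (X.committee v' t) (X.view v' t) t) c
  set H := X.honestSupport (X.committee v' t) s c
  -- An honest supporter at slot `s` either has not voted validly since, or has since voted for a
  -- descendant of `b`.
  have hsub1 : H ⊆ G ∩ X.honest := by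
    rw [hH]
    rintro i ⟨hi, k, ⟨⟨hk, hvk, hKk⟩, hmax⟩, hb⟩
    obtain ⟨k', -, hl⟩ := exists_latestVote (X := X) (hk.trans_le hst) hvk hKk
    refine ⟨hi, k', hl, ?_⟩
    by_cases hk' : k' < s
    · have h1 := hmax k' hk' hl.1.2.1 hl.1.2.2
      have h2 := hl.2 k (hk.trans_le hst) hvk hKk
      rwa [le_antisymm h1 h2]
    · exact hc.trans (hvotes i hi k' (not_lt.mp hk') hl.1.1)
  -- The committees added since slot `s` consist of validators whose honest members voted for
  -- descendants of `b`.
  have hsub2 : (S \ A) ∩ X.honest ⊆ G ∩ X.honest := by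
    rw [hH]
    rintro i ⟨⟨⟨k, h1, h2, h3⟩, hnA⟩, hi⟩
    have hsk : s ≤ k := by
      by_contra hlt
      exact hnA ⟨k, h1, by rw [slotAt_slotStart]; exact not_le.mp hlt, by rw [hK]; exact h3⟩
    have hvk := hA.run.votesIn_of_mem_committee hv' hi ht
      (hs.trans (P.slotStart_strictMono.monotone hsk)) h3
    obtain ⟨k', hkk', hl⟩ := exists_latestVote (X := X) h2 hvk h3
    exact ⟨hi, k', hl, hc.trans (hvotes i hi k' (hsk.trans hkk') hl.1.1)⟩
  have e1 : X.honestWeight (H ∩ A) + X.honestWeight (S \ A) ≤ X.honestWeight G := by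
    unfold honestWeight
    rw [← weight_union _ (Set.disjoint_left.mpr fun i h h' => h'.1.2 h.1.2)]
    exact weight_mono _ (Set.union_subset (fun i h => hsub1 h.1.1) hsub2)
  have e2 : X.honestWeight S ≤ X.honestWeight A + X.honestWeight (S \ A) := by
    refine le_trans (weight_mono _ ?_) (weight_union_le _ _ _)
    rintro i ⟨h1, h2⟩
    by_cases h3 : i ∈ A
    · exact Or.inl ⟨h3, h2⟩
    · exact Or.inr ⟨⟨h1, h3⟩, h2⟩
  have e3 : (1 - β) * weight (P.eba x) S ≤ X.honestWeight S :=
    hA.beta_bound hv' ht _ _ x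
  have e4 : P.boostWeight (P.eba x) ≤ P.boostWeight (P.eba C.block) :=
    boostWeight_mono (hA.weight_anti hx _)
  have e5 := hA.honestWeight_le x G
  have hβ := hA.beta.1
  have hβ' := hA.lt_sixth
  have hp : 0 < 1 - β := by linarith
  have e6 := honestWeight_nonneg (X := X) (S \ A)
  refine lt_of_mul_lt_mul_left ?_ hp.le
  calc (1 - β) * (weight (P.eba x) S + P.boostWeight (P.eba x))
      = (1 - β) * weight (P.eba x) S + (1 - β) * P.boostWeight (P.eba x) := by ring
    _ ≤ X.honestWeight A + X.honestWeight (S \ A) + (1 - β) * P.boostWeight (P.eba C.block) :=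
        add_le_add (e3.trans e2) (mul_le_mul_of_nonneg_left e4 hp.le)
    _ < 2 * (1 - β) * X.honestWeight (H ∩ A) + X.honestWeight (S \ A) := by linarith
    -- New honest weight enters the right-hand side with factor `2 * (1 - β) ≥ 1`, so new committees
    -- never shrink the margin.
    _ ≤ 2 * (1 - β) * X.honestWeight (H ∩ A) + 2 * (1 - β) * X.honestWeight (S \ A) := by
        have := mul_nonneg (by linarith : 0 ≤ 2 * (1 - β) - 1) e6
        linarith
    _ = 2 * (1 - β) * (X.honestWeight (H ∩ A) + X.honestWeight (S \ A)) := by ring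
    _ ≤ 2 * (1 - β) * weight (P.eba x) G :=
        mul_le_mul_of_nonneg_left (e1.trans e5) (by linarith)
    _ = _ := by ring

/-- A block above or below the greatest justified checkpoint is not removed by the FFG filter if
all its leaves have recent voting sources. -/
theorem keptByHFC {t : Time} {b b₀ : B}
    (hG : P.Anc b (X.gjAt v t).block ∨
      P.ChkpAncBlock (X.gjAt v t) b ∧ (X.gjAt v t).block ≠ b)
    (hb₀ : b₀ ∈ blocksOf (X.view v t)) (hb : P.Anc b b₀) (hs : P.slot b₀ ≤ P.slotAt t)
    (hvs : ∀ x, P.Anc b₀ x → P.slot x ≤ P.slotAt t →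
      P.epochAt t ≤ (P.votingSource x (P.epochAt t)).epoch + 2)
    {a : B} (ha : P.Anc a b) : P.KeptByHFC (X.view v t) t a := by
  rcases hG with hG | ⟨hG, hne⟩
  · exact Or.inl (ha.trans hG)
  rcases ha.total hG.anc with h | h
  · exact Or.inl h
  -- The chain of `b` has passed the epoch boundary of the justified checkpoint, so all descendants
  -- of `b` have the same checkpoint there.
  · have hslot : P.firstSlot (X.gjAt v t).epoch < P.slot b := by
      by_contra hc
      exact hne (hG.anc.antisymm (hG.anc_of_slot_le (Anc.refl P b) (not_lt.mp hc)))
    -- A received descendant of `b₀` of the highest slot has no children, and serves as the leaf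
    -- that the filter asks for.
    obtain ⟨x, ⟨hx1, hx2, hx3⟩, hmax⟩ := Set.exists_max_image
      {x | x ∈ blocksOf (X.view v t) ∧ P.Anc b₀ x ∧ P.slot x ≤ P.slotAt t} P.slot
      ((hA.run.blocksOf_view_finite hv t).subset fun x hx => hx.1) ⟨b₀, hb₀, Anc.refl P _, hs⟩
    have hGx : P.ChkpAncBlock (X.gjAt v t) x :=
      (chkp_eq_of_anc (hb.trans hx2) hslot.le).trans hG
    refine Or.inr ⟨h, x, hx1, ha.trans (hb.trans hx2),
      ChkpAncBlock.trans (hA.gasper.gf_anc_gj v hv t) hGx, epoch_le_epochAt hx3, ?_,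
      Or.inr (hvs x hx2 hx3)⟩
    refine Set.eq_empty_of_forall_notMem fun y ⟨hy1, hy2, hy3, hy4⟩ => ?_
    have hyx : P.Anc b₀ y := hx2.trans (hy3 ▸ anc_parent y)
    have h1 := hmax y ⟨hy1, hyx, hy4⟩
    have h2 := P.slot_parent_lt y hy2
    rw [hy3] at h2
    exact absurd h1 (not_le.mpr h2)

/-- A block found LMD-GHOST safe is canonical if the honest validators have voted for it since and
it is not removed by the FFG filter. -/
theorem anc_forkChoice {s : ℕ} (hs : X.ggst ≤ P.slotStart s) {b : B} {C : Checkpoint B}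
    (hsafe : X.isLMDGHOSTSafe β v b C (P.slotStart s))
    {v' : V} (hv' : v' ∈ X.honest) {t : Time} (hst : s ≤ P.slotAt t)
    (hvotes : ∀ i ∈ X.honest, ∀ k, s ≤ k → k < P.slotAt t →
      P.Anc b (X.forkChoice i (X.voteTime i k)))
    (hC : P.Anc C.block (X.gjAt v' t).block)
    (hkept : ∀ a, P.Anc a b → P.KeptByHFC (X.view v' t) t a) :
    P.Anc b (X.forkChoice v' t) := by
  have hst' : P.slotStart s ≤ t := (P.slotStart_le_iff _ _).mpr hst
  have hM : (blocksOf (P.filLmdGhost (X.committee v' t) (P.filHfc (X.view v' t) t) t)).Finite :=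
    (hA.run.blocksOf_view_finite hv' t).subset fun b hb =>
      (mem_blocksOf_filHfc.mp (mem_blocksOf_filLmdGhost.mp hb)).1
  refine anc_ghost hA.run.tie_mem hM fun c hcg hcb => ?_
  obtain ⟨i, hi, k, hk, hci⟩ := hA.exists_voter_of_isLMDGHOSTSafe hv hs hsafe hcb hcg
  constructor
  · refine ⟨mem_blocksOf_filLmdGhost.mpr (mem_blocksOf_filHfc.mpr
      ⟨hA.run.mem_view_of_anc_forkChoice hv' hi hci (hk.trans_le hst) (hs.trans hst'),
        hkept c hcb⟩), hcg, rfl, ?_⟩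
    have := hA.run.slot_le_of_anc_voteTime hi hci
    omega
  · rintro c' ⟨-, hcg', hpar, -⟩ hne
    have hmargin := hA.ghostVoters_margin hv hs hsafe hcb hcg hv' hst hvotes hC
    have hslot := P.slot_parent_lt c hcg
    have hslot' := P.slot_parent_lt c' hcg'
    rw [hpar] at hslot'
    -- A valid vote is not older than its block and is from a past slot, so supporters of either
    -- sibling sit in the committees of the range.
    have hsub : ∀ y, P.slot (P.parent c) < P.slot y →
        P.ghostVoters (P.filLmdGhost (X.committee v' t) (X.view v' t) t) y ⊆
          X.blockCommittees v' t c := by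
      rintro y hy i ⟨a, ha, rfl, hya⟩
      obtain ⟨⟨-, -, h1, h2, h3⟩, -⟩ := mem_ghostsOf_filLmdGhost.mp ha
      have := hya.slot_le
      exact ⟨a.slot, by omega, h1, h2⟩
    have hdisj : Disjoint
        (P.ghostVoters (P.filLmdGhost (X.committee v' t) (X.view v' t) t) c)
        (P.ghostVoters (P.filLmdGhost (X.committee v' t) (X.view v' t) t) c') := by
      refine disjoint_ghostVoters fun x hx hx' => ?_
      rcases hx.total hx' with h | h
      · have := (parent_anc_of_ne h (Ne.symm hne)).slot_le
        rw [hpar] at this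
        omega
      · have := (parent_anc_of_ne h hne).slot_le
        omega
    -- The two disjoint groups of supporters share the weight of the range. As twice the support of
    -- `c` exceeds that weight plus the boost, `c` wins even if the boost goes to the sibling.
    have hsum := weight_union (P.eba (X.gjAt v' t).block) hdisj
    have hle := weight_mono (P.eba (X.gjAt v' t).block)
      (Set.union_subset (hsub c hslot) (hsub c' hslot'))
    have hb := boostWeight_nonneg (P := P) (P.eba (X.gjAt v' t).block)
    simp only [ghostWeight, ghostVoters_filHfc]
    change weight (P.eba (X.gjAt v' t).block) _ + _ < weight (P.eba (X.gjAt v' t).block) _ + _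
    have h1 : ∀ p : Prop, ∀ _ : Decidable p,
        (if p then P.boostWeight (P.eba (X.gjAt v' t).block) else 0) ≤
          P.boostWeight (P.eba (X.gjAt v' t).block) := fun p _ => by
      split_ifs
      · exact le_rfl
      · exact hb
    have h2 : ∀ p : Prop, ∀ _ : Decidable p,
        0 ≤ (if p then P.boostWeight (P.eba (X.gjAt v' t).block) else 0) := fun p _ => by
      split_ifs
      · exact hb
      · exact le_rfl
    refine (add_le_add_right (h1 _ _) _).trans_lt (lt_of_lt_of_le ?_ (le_add_of_nonneg_right
      (h2 _ _)))
    linarith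

end Assumptions

end Execution

/-! ### FFG votes and the passage to the next epoch. -/

namespace Execution

open Protocol

variable {V B : Type*} {P : Protocol V B} {X : Execution P}

theorem committees_self (v : V) (t : Time) (s : ℕ) : X.committees v t s s = ∅ :=
  Set.eq_empty_of_forall_notMem fun _ ⟨_, h1, h2, _⟩ => absurd h2 (not_lt.mpr h1)

/-- The FFG votes for the checkpoint of `b` in epoch `e` sent by the end of that epoch suffice for
its justification even after slashing. -/
def ChkpVoted (X : Execution P) (β : ℝ) (W : ℝ≥0∞) (b : B) (e : ℕ) : Prop :=
  2 / 3 * totalWeight (P.eba (P.chkp b e).block) +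
      (min W (ENNReal.ofReal (β * totalWeight (P.eba (P.chkp b e).block)))).toReal ≤
    weight (P.eba (P.chkp b e).block)
      (ffgVoters (X.sent (P.epochStart (e + 1))) (P.votingSource b e) (P.chkp b e))

/-- Block `b` of an epoch up to `e` is found confirmed at the start of epoch `e + 1`, and is not
lower than the justified checkpoints of epoch `e - 1`. -/
structure ConfirmedAtEpochStart (X : Execution P) (β : ℝ) (W : ℝ≥0∞) (v : V) (b : B) (e : ℕ) :
    Prop where
  ggst_le : X.ggst ≤ P.epochStart e
  mem_view : b ∈ blocksOf (X.view v (P.epochStart (e + 1)))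
  justified : X.willChkpBeJustified β W v b e (P.epochStart (e + 1))
  witness : ∃ b' ∈ blocksOf (X.view v (P.slotStart (P.firstSlot (e + 1) - 1))),
    P.Anc b b' ∧ P.epoch b' < e + 1 ∧ e + 1 ≤ (P.votingSource b' (e + 1)).epoch + 2 ∧
      X.isLMDGHOSTSafe β v b (P.votingSource b' (e + 1)) (P.epochStart (e + 1))
  slot_le : ∀ D : Checkpoint B, P.CanBeJustified D → D.epoch + 1 = e → P.slot D.block ≤ P.slot b

/-- Block `b` is found confirmed at the start of a slot `s` of its own epoch. -/
structure ConfirmedInEpoch (X : Execution P) (β : ℝ) (W : ℝ≥0∞) (v : V) (b : B) (s : ℕ) :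
    Prop where
  ggst_le : X.ggst ≤ P.epochStart (P.epoch b)
  epoch_eq : P.epochOfSlot s = P.epoch b
  justified : X.willChkpBeJustified β W v b (P.epoch b) (P.slotStart s)
  source : (P.gj b).epoch + 1 = P.epoch b
  safe : X.isLMDGHOSTSafe β v b (P.gj b) (P.slotStart s)

theorem ChkpVoted.two_thirds_le {β : ℝ} {W : ℝ≥0∞} {b : B} {e : ℕ}
    (h : X.ChkpVoted β W b e) {t : Time}
    (ht : P.epochStart (e + 1) ≤ t) :
    2 / 3 * totalWeight (P.eba (P.chkp b e).block) ≤
      weight (P.eba (P.chkp b e).block) (ffgTargetVoters (X.sent t) (P.chkp b e)) := by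
  refine le_trans (le_trans (le_add_of_nonneg_right ENNReal.toReal_nonneg) h) (weight_mono _ ?_)
  intro i hi
  exact ⟨_, sent_mono ht hi⟩

namespace Assumptions

variable {β d : ℝ} {W : ℝ≥0∞} (hA : X.Assumptions β d W)

include hA

theorem justified_unique {C D : Checkpoint B} (hC : P.CanBeJustified C) (hD : P.CanBeJustified D)
    (h : C.epoch = D.epoch) : C = D :=
  hA.gasper.justified_unique hA.lt_third C D hC hD h

variable {v : V} (hv : v ∈ X.honest)

include hv

/-- The bound by `W` is the slashing bound, since genesis balances are the largest. The bound by `β`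
holds because slashed validators are Byzantine. -/
theorem weight_slashed_le {a b : B} :
    weight (P.eba a) (P.slashed b) ≤
      (min W (ENNReal.ofReal (β * totalWeight (P.eba a)))).toReal := by
  have h1 : ENNReal.ofReal (weight (P.eba a) (P.slashed b)) ≤ W :=
    (ENNReal.ofReal_le_ofReal (hA.weight_anti (gen_anc a) _)).trans (hA.slash b)
  have h2 : weight (P.eba a) (P.slashed b) ≤ β * totalWeight (P.eba a) := by
    have h3 := hA.beta_bound_total hv a
    rw [← hA.weight_inter_honest a] at h3
    have h4 : weight (P.eba a) (Set.univ ∩ X.honest) + weight (P.eba a) (Set.univ \ X.honest) =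
        totalWeight (P.eba a) := weight_inter_add_diff _ _ _
    have h5 : weight (P.eba a) (P.slashed b) ≤ weight (P.eba a) (Set.univ \ X.honest) :=
      weight_mono _ fun i hi => ⟨Set.mem_univ i, fun hh => hA.run.honest_not_slashed i hh b hi⟩
    linarith
  refine (ENNReal.ofReal_le_iff_le_toReal ?_).mp (le_min h1 (ENNReal.ofReal_le_ofReal h2))
  exact ((min_le_right _ _).trans_lt ENNReal.ofReal_lt_top).ne

/-- The surplus over two thirds pays for the slashed voters. The remaining voters keep their
balances in `b'`, while the total can only go down. -/
theorem two_thirds_le_diff_slashed {b b' : B} {e : ℕ} (h : X.ChkpVoted β W b e)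
    (hb : P.ChkpAncBlock (P.chkp b e) b') {t : Time} (ht : P.epochStart (e + 1) ≤ t) :
    2 / 3 * totalWeight (P.eba b') ≤ weight (P.eba b')
      (ffgVoters (X.sent t) (P.votingSource b e) (P.chkp b e) \ P.slashed b') := by
  have hanc := hb.anc
  rw [ChkpVoted] at h
  set a := (P.chkp b e).block
  set F := ffgVoters (X.sent t) (P.votingSource b e) (P.chkp b e)
  have h1 : weight (P.eba a) (ffgVoters (X.sent (P.epochStart (e + 1))) (P.votingSource b e)
      (P.chkp b e)) ≤ weight (P.eba a) F := weight_mono _ fun i hi => sent_mono ht hi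
  have h2 := weight_inter_add_diff (P.eba a) F (P.slashed b')
  have h3 : weight (P.eba a) (F ∩ P.slashed b') ≤ weight (P.eba a) (P.slashed b') :=
    weight_mono _ Set.inter_subset_right
  have h4 := hA.weight_slashed_le hv (a := a) (b := b')
  have h5 : weight (P.eba b') (F \ P.slashed b') = weight (P.eba a) (F \ P.slashed b') :=
    weight_eq_of_forall fun i hi => hA.fixed.eba_eq a b' hanc i hi.2
  have h6 : totalWeight (P.eba b') ≤ totalWeight (P.eba a) := hA.weight_anti hanc _
  rw [h5]
  linarith

/-- Voting sources come from blocks of earlier epochs, which bounds their epochs; the genesis block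
makes the set of candidates nonempty. -/
theorem gjAt_spec {t : Time} (ht : 0 < P.epochAt t) :
    P.CanBeJustified (X.gjAt v t) ∧ (X.gjAt v t).epoch < P.epochAt t ∧
      ∀ b ∈ blocksOf (X.view v t), P.slot b ≤ P.slotAt t →
        (P.votingSource b (P.epochAt t)).epoch ≤ (X.gjAt v t).epoch := by
  have hlt : ∀ C ∈ {C | ∃ b ∈ blocksOf (X.view v t), P.slot b ≤ P.slotAt t ∧
      C = P.votingSource b (P.epochAt t)}, P.CanBeJustified C ∧ C.epoch < P.epochAt t := by
    rintro _ ⟨b, -, hb, rfl⟩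
    exact hA.gasper.canBeJustified_votingSource (epoch_le_epochAt hb) ht
  obtain ⟨h1, h2⟩ := greatest_mem (P := P) <| exists_greatest
    (S := {C | ∃ b ∈ blocksOf (X.view v t), P.slot b ≤ P.slotAt t ∧
      C = P.votingSource b (P.epochAt t)})
    ⟨_, P.gen, hA.run.gen_mem_view v hv t, by rw [P.slot_gen]; exact Nat.zero_le _, rfl⟩
    fun C hC => (hlt C hC).2.le
  exact ⟨(hlt _ h1).1, (hlt _ h1).2, fun b hb hs => h2 _ ⟨b, hb, hs, rfl⟩⟩

/-- In the epoch after that of an FFG vote of two thirds, the greatest justified checkpoint does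
not conflict with the block voted for. -/
theorem gjAt_comparable {b b₀ : B} {e : ℕ} {t : Time} (ht : P.epochAt t = e + 1)
    (hb : P.Anc b b₀) (hb₀ : b₀ ∈ blocksOf (X.view v t)) (he : P.epoch b₀ < e + 1)
    (hJ : e ≤ (P.gu b₀).epoch + 1) (hvoted : X.ChkpVoted β W b e)
    (hslot : (P.gu b₀).epoch + 1 = e → P.slot (P.gu b₀).block ≤ P.slot b) :
    (P.Anc b (X.gjAt v t).block ∨ P.ChkpAncBlock (X.gjAt v t) b ∧ (X.gjAt v t).block ≠ b) ∧
      P.Anc (P.gu b₀).block (X.gjAt v t).block ∧ (P.gu b₀).epoch ≤ (X.gjAt v t).epoch := by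
  obtain ⟨hG, hlt, hmax⟩ := hA.gjAt_spec hv (t := t) (by omega)
  have hJ₀ := hA.gasper.chkpAncBlock_gu b₀
  have hJG : (P.gu b₀).epoch ≤ (X.gjAt v t).epoch := by
    have hs : P.slot b₀ ≤ P.slotAt t := by
      have h1 := epoch_lt_iff.mp he
      have h2 := (epochAt_eq_iff.mp ht).1
      omega
    have := hmax b₀ hb₀ hs
    rw [ht] at this
    rwa [show P.votingSource b₀ (e + 1) = P.gu b₀ from if_pos he] at this
  rw [ht] at hlt
  set G := X.gjAt v t
  have hself : ∀ {y}, P.ChkpAncBlock G y → P.Anc b y →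
      P.Anc b G.block ∨ P.ChkpAncBlock G b ∧ G.block ≠ b := by
    intro y hy hby
    by_cases hbG : P.Anc b G.block
    · exact Or.inl hbG
    · exact Or.inr ⟨hy.of_anc hby ((hby.total hy.anc).resolve_left hbG),
        fun h => hbG (h ▸ Anc.refl P _)⟩
  -- The epoch of `G` is at least that of `GU(b₀)`, which is at least `e - 1`, and at most `e`.
  -- Either the two epochs agree and uniqueness identifies the checkpoints, or `G` has epoch `e` and
  -- the FFG votes force it to be the checkpoint of `b`.
  rcases hJG.eq_or_lt with heq | hne
  · have hGJ : P.gu b₀ = G := hA.justified_unique ⟨b₀, (hA.gasper.gu_spec b₀).1⟩ hG heq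
    rw [← hGJ] at hself ⊢
    exact ⟨hself hJ₀ hb, Anc.refl P _, le_rfl⟩
  · have hJe : (P.gu b₀).epoch + 1 = e := by omega
    -- The slot hypothesis matters here: `b` might be much older than `b₀`, and must not lie
    -- strictly below the block of this checkpoint.
    have hJb : P.ChkpAncBlock (P.gu b₀) b :=
      hJ₀.of_anc hb (anc_of_slot_le hJ₀.anc hb (hslot hJe))
    have hJC : P.ChkpAnc (P.gu b₀) (P.chkp b e) := by
      refine Or.inr ⟨by rw [chkp_epoch]; omega, ?_⟩
      exact (chkp_chkp_block (by omega)).trans hJb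
    have hGC : G = P.chkp b e := by
      by_contra hne'
      exact hA.gasper.no_other_justified hA.lt_third v hv t (P.chkp b e)
        (Or.inr ⟨P.gu b₀, ⟨b₀, (hA.gasper.gu_spec b₀).1⟩, hJe, hJC⟩)
        (hvoted.two_thirds_le (epochStart_le_iff.mpr ht.ge)) G
        (by rw [chkp_epoch]; omega) hne' hG
    have hGb : P.ChkpAncBlock G b := by
      rw [hGC]
      exact chkpAncBlock_chkp b e
    exact ⟨hself hGb (Anc.refl P b), hGb.anc_of_slot_le hJb.anc
      (hJb.slot_le.trans (firstSlot_mono hJG)), hJG⟩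

/-- If a block is canonical during epoch `e + 1` and its checkpoint of epoch `e` has received enough
FFG votes, then a descendant is found confirmed at the start of epoch `e + 2`. -/
theorem exists_confirmedAtEpochStart {b : B} {e : ℕ} (hb : P.epoch b ≤ e)
    (hg : X.ggst ≤ P.epochStart (e + 1)) (hvoted : X.ChkpVoted β W b e)
    (hcanon : ∀ t, P.epochAt t = e + 1 → ∀ i ∈ X.honest, P.Anc b (X.forkChoice i t)) :
    ∃ c, P.Anc b c ∧ X.ConfirmedAtEpochStart β W v c (e + 1) := by
  obtain ⟨C, hCe, hbC, ⟨b', hb'v, hCb', hb'e, hj⟩, hvotes⟩ := hA.strong b e hb hg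
    (fun t ht i hi => ⟨hcanon t ht i hi, fun b' _ hb' =>
      hA.two_thirds_le_diff_slashed hv hvoted hb' (epochStart_le_iff.mpr ht.ge)⟩) v hv
  have hlast : P.lastSlot (e + 1) = P.firstSlot (e + 1 + 1) - 1 := by
    rw [← lastSlot_add_one, Nat.add_sub_cancel]
  rw [hlast] at hb'v
  have hτg : X.ggst ≤ P.epochStart (e + 1 + 1) := hg.trans (epochStart_mono (Nat.le_succ _))
  have hτs : P.slotAt (P.epochStart (e + 1 + 1)) = P.firstSlot (e + 1 + 1) := slotAt_slotStart _
  have hslotC : P.slot C.block ≤ P.firstSlot (e + 1) := hCe ▸ hCb'.slot_le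
  have hchkp : P.chkp C.block (e + 1) = C := by
    rw [chkp_eq_self hslotC, ← hCe]
  have hv1 := hvotes _ le_rfl
  rw [hCe] at hv1
  set τ := P.epochStart (e + 1 + 1)
  set Y := ffgVoters (X.view v τ) (P.votingSource C.block (e + 1)) C ∩ X.honest with hY
  -- An honest FFG vote for `C` reveals a slot of epoch `e + 1` in which the signer's head was above
  -- `C.block`, hence a GHOST vote supporting that block.
  have hYk : ∀ i ∈ Y, i ∈ X.honest ∧ ∃ k, X.VotesIn i k ∧ P.firstSlot (e + 1) ≤ k ∧
      k < P.firstSlot (e + 1 + 1) ∧ i ∈ X.committee v τ k ∧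
      P.Anc C.block (X.forkChoice i (X.voteTime i k)) := by
    rintro i ⟨hi, hih⟩
    obtain ⟨k, hk, -, heq⟩ :=
      hA.run.ffg_unforgeable τ _ (hA.run.view_subset_sent hv τ hi) hih
    have hC : C = P.chkp (X.forkChoice i (X.voteTime i k)) (P.epochOfSlot k) :=
      congrArg FFGVote.target heq
    have hke : P.epochOfSlot k = e + 1 := by
      rw [← hCe, hC, chkp_epoch]
    obtain ⟨hk1, hk2⟩ := epochOfSlot_eq_iff.mp hke
    refine ⟨hih, k, hk, hk1, hk2, ?_, ?_⟩
    · exact hA.run.mem_committee_of_votesIn hv hih hτg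
        (hg.trans (P.slotStart_strictMono.monotone hk1)) hk
    · have := (P.chkp_spec (X.forkChoice i (X.voteTime i k)) (P.epochOfSlot k)).1
      rwa [← hC] at this
  have hYw : ∀ x, weight (P.eba x) Y = X.honestWeight Y := fun x => by
    rw [← hA.weight_inter_honest x, hY, Set.inter_assoc, Set.inter_self]
  have hβ := hA.beta.1
  have hβ' := hA.lt_sixth
  have hp : 0 < 1 - β := by linarith
  set H := X.honestWeight Set.univ
  have hH0 : 0 ≤ H := honestWeight_nonneg _
  -- By the `β`-bound, `q` dominates the total weight and the weight of any range of committees from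
  -- `GGST` on, according to any block. The ratio `honFFGRatio` is designed so that the honest votes
  -- exceed `(2 / 3 + β) * q`.
  set q := H / (1 - β)
  have hq0 : 0 ≤ q := div_nonneg hH0 hp.le
  have hq : ∀ r : ℝ, (1 - β) * r ≤ H → r ≤ q := fun r hr => by
    rw [le_div_iff₀ hp]
    linarith
  have hYq : (2 / 3 + β) * q < X.honestWeight Y := by
    rw [hYw, ← Set.univ_inter X.honest, hA.weight_inter_honest] at hv1
    have : honFFGRatio β * H = (2 / 3 + β) * q := by
      simp only [honFFGRatio, q]
      ring
    rwa [this] at hv1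
  have hYpos : 0 < X.honestWeight Y := (mul_nonneg (by linarith) hq0).trans_lt hYq
  have hHpos : 0 < H := hYpos.trans_le (honestWeight_mono (Set.subset_univ _))
  have hmem : C.block ∈ blocksOf (X.view v τ) := by
    obtain ⟨i, hi⟩ := exists_mem_of_weight_pos hYpos
    obtain ⟨hih, k, -, -, hk, -, hanc⟩ := hYk i hi.1
    exact hA.run.mem_view_of_anc_forkChoice hv hih hanc (hτs ▸ hk) hτg
  have hvs : P.votingSource b' (e + 1 + 1) = P.gu b' := if_pos hb'e
  refine ⟨C.block, hbC, hg, hmem, ?_, ⟨b', hb'v, hCb'.anc, hb'e, ?_, ?_⟩, ?_⟩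
  · simp only [willChkpBeJustified, hchkp]
    rw [hτs, committees_self, weight_empty, mul_zero, add_zero]
    have h1 := hq _ (hA.beta_bound_total hv C.block)
    have hT : 0 ≤ totalWeight (P.eba C.block) := weight_nonneg _ _
    have h2 : (min W (ENNReal.ofReal (β * totalWeight (P.eba C.block)))).toReal ≤
        β * totalWeight (P.eba C.block) :=
      ENNReal.toReal_le_of_le_ofReal (mul_nonneg hβ hT) (min_le_right _ _)
    have h3 := mul_le_mul_of_nonneg_left h1 (by linarith : 0 ≤ 2 / 3 + β)
    have h4 : X.honestWeight Y ≤ weight (P.eba C.block)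
        (ffgVoters (X.view v τ) (P.votingSource C.block (e + 1)) C ∩
          X.committees v τ (P.firstSlot (e + 1)) (P.firstSlot (e + 1 + 1))) := by
      rw [← hYw C.block]
      refine weight_mono _ fun i hi => ⟨hi.1, ?_⟩
      obtain ⟨-, k, -, hk1, hk2, hk3, -⟩ := hYk i hi
      exact ⟨k, hk1, hk2, hk3⟩
    linarith
  · have h1 := (hA.gasper.gu_spec b').2 _ hj
    rw [chkp_epoch] at h1
    rw [hvs]
    omega
  · intro c hc
    rw [or_iff_not_imp_left]
    intro hcg
    rw [hvs, indicatorQ]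
    have hcs : P.slot (P.parent c) + 1 ≤ P.firstSlot (e + 1) :=
      (P.slot_parent_lt c hcg).trans_le (hc.slot_le.trans hslotC)
    -- The committees of an epoch are disjoint, so each signer has a single valid vote in epoch `e +
    -- 1`, which is its latest.
    have hsub : Y ⊆ X.support v τ c := by
      intro i hi
      obtain ⟨hih, k, hk, hk1, hk2, hk3, hanc⟩ := hYk i hi
      refine ⟨?_, k, hcs.trans hk1, by rwa [hτs], hk3⟩
      have hin : i ∈ X.honestSupport (X.committee v τ) (P.slotAt τ) c := by
        obtain ⟨k', hkk', hl⟩ := exists_latestVote (X := X) (K := X.committee v τ)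
          (by rwa [hτs] : k < P.slotAt τ) hk hk3
        have heq : k' = k := by
          by_contra hne
          have hlt := hl.1.1
          rw [hτs] at hlt
          have hdis := hA.run.committee_disjoint v hv τ k' k hne
            ((epochOfSlot_eq_iff.mpr ⟨hk1.trans hkk', hlt⟩).trans
              (epochOfSlot_eq_iff.mpr ⟨hk1, hk2⟩).symm)
          exact Finset.disjoint_left.mp hdis hl.1.2.2 hk3
        rw [heq] at hl
        exact ⟨hih, k, hl, hc.trans hanc⟩
      rw [← hA.run.ghostVoters_inter_honest hv hτg] at hin
      exact hin.1
    have hSle : weight (P.eba (P.gu b').block) (X.blockCommittees v τ c) ≤ q :=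
      hq _ ((hA.beta_bound hv hτg _ _ _).trans (honestWeight_mono (Set.subset_univ _)))
    -- The parent of `c` precedes epoch `e + 1`, so the range contains a whole epoch and with it all
    -- the honest weight.
    have hSge : H ≤ weight (P.eba (P.gu b').block) (X.blockCommittees v τ c) := by
      refine le_trans ?_ (hA.honestWeight_le _ _)
      refine weight_le_weight fun i hi hpos => ⟨?_, le_rfl⟩
      have hmem : i ∈ X.validatorSet v τ (e + 1) ∩ X.honest := by
        rw [hA.fixed.honest_validatorSet v hv τ hτg]
        exact ⟨hpos, hi.2⟩
      exact ⟨committees_mono hcs hτs.ge hmem.1, hmem.2⟩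
    have hT := hA.beta_bound_total hv (P.gu b').block
    have hsupp := weight_mono (P.eba (P.gu b').block) hsub
    rw [hYw] at hsupp
    set w := P.eba (P.gu b').block
    have hT0 : 0 ≤ totalWeight w := weight_nonneg _ _
    have hboost : P.boostWeight w ≤ 5 / 18 * totalWeight w :=
      mul_le_mul_of_nonneg_right hA.gasper.boost_lt.le hT0
    -- From `β < 1 / 6`. With the bound `5 / 18`, the boost is at most a third of `H`, hence of the
    -- committee weight, so the threshold is at most `(2 / 3 + β)` times the committee weight.
    have hT' : 5 / 6 * totalWeight w ≤ H :=
      (mul_le_mul_of_nonneg_right (by linarith) hT0).trans hT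
    have hSpos := hHpos.trans_le hSge
    rw [lt_div_iff₀ hSpos]
    have h6 : (1 / 2 * (1 + P.boostWeight w / weight w (X.blockCommittees v τ c)) + β) *
        weight w (X.blockCommittees v τ c) = 1 / 2 * weight w (X.blockCommittees v τ c) +
          1 / 2 * P.boostWeight w + β * weight w (X.blockCommittees v τ c) := by
      field_simp
    change (1 / 2 * (1 + P.boostWeight w / weight w (X.blockCommittees v τ c)) + β) *
        weight w (X.blockCommittees v τ c) < weight w (X.support v τ c)
    rw [h6]
    have h7 := mul_le_mul_of_nonneg_left hSle (by linarith : 0 ≤ 2 / 3 + β)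
    linarith
  · intro D hD hDe
    -- `C.block` may be older than epoch `e + 1`, so slots alone do not suffice: the only justified
    -- checkpoint of epoch `e` is that of `b`, which lies below `C.block`.
    have h1 : D = P.chkp b e :=
      hA.justified_unique hD ⟨b', hj⟩ (by rw [chkp_epoch]; omega)
    rw [h1]
    exact ((P.chkp_spec b e).1.trans hbC).slot_le

end Assumptions

end Execution

/-! ### Confirmed blocks stay canonical. -/

namespace Execution

open Protocol

variable {V B : Type*} {P : Protocol V B} {X : Execution P}

theorem ConfirmedAtEpochStart.epoch_le {β : ℝ} {W : ℝ≥0∞} {v : V} {b : B} {e : ℕ}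
    (h : X.ConfirmedAtEpochStart β W v b e) : P.epoch b ≤ e := by
  obtain ⟨b', -, hb, he, -⟩ := h.witness
  have := hb.epoch_le
  omega

/-- At the start of the next epoch no committee of epoch `e` is left, so the test counts only votes
already received. -/
theorem ConfirmedAtEpochStart.chkpVoted {β d : ℝ} {W : ℝ≥0∞} {v : V} {b : B} {e : ℕ}
    (hA : X.Assumptions β d W) (hv : v ∈ X.honest)
    (h : X.ConfirmedAtEpochStart β W v b e) : X.ChkpVoted β W b e := by
  have h1 := h.justified
  simp only [willChkpBeJustified, epochStart, slotAt_slotStart, committees_self, weight_empty,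
    mul_zero, add_zero] at h1
  exact h1.trans (weight_mono _ fun i hi => hA.run.view_subset_sent hv _ hi.1)

theorem ConfirmedAtEpochStart.isConfirmedNoCaching {β : ℝ} {W : ℝ≥0∞} {v : V} {b : B} {e : ℕ}
    (h : X.ConfirmedAtEpochStart β W v b e) :
    X.isConfirmedNoCaching β W v b (P.slotStart (P.firstSlot (e + 1))) := by
  have h1 : P.epochAt (P.slotStart (P.firstSlot (e + 1))) = e + 1 := by
    rw [epochAt_slotStart, epochOfSlot_firstSlot]
  have h2 := h.epoch_le
  rw [Execution.isConfirmedNoCaching, h1, if_neg (by omega), slotAt_slotStart, Nat.add_sub_cancel]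
  exact ⟨rfl, h.justified, h.witness⟩

theorem ConfirmedInEpoch.ggst_le_slotStart {β : ℝ} {W : ℝ≥0∞} {v : V} {b : B} {s : ℕ}
    (h : X.ConfirmedInEpoch β W v b s) : X.ggst ≤ P.slotStart s :=
  h.ggst_le.trans (P.slotStart_strictMono.monotone (firstSlot_le_iff.mpr h.epoch_eq.ge))

/-- The two ways in which a block can be found confirmed since the second slot of an epoch. -/
theorem confirmed_cases {β : ℝ} {W : ℝ≥0∞} {v : V} {g : B} {e s : ℕ}
    (hg : X.ggst ≤ P.epochStart e)
    (hs : P.firstSlot e + 1 ≤ s) (hs' : P.epochOfSlot s ≤ e + 1)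
    (hview : g ∈ blocksOf (X.view v (P.slotStart s)))
    (hconf : X.isConfirmedNoCaching β W v g (P.slotStart s))
    (hslot : ∀ D : Checkpoint B, P.CanBeJustified D → D.epoch + 1 = e →
      P.slot D.block ≤ P.slot g) :
    X.ConfirmedInEpoch β W v g s ∨
      s = P.firstSlot (e + 1) ∧ X.ConfirmedAtEpochStart β W v g e := by
  have hse : e ≤ P.epochOfSlot s := firstSlot_le_iff.mp (by omega)
  rw [isConfirmedNoCaching, epochAt_slotStart, slotAt_slotStart] at hconf
  split_ifs at hconf with hge
  · left
    rw [← hge] at hconf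
    exact ⟨hg.trans (epochStart_mono (hge ▸ hse)), hge.symm, hconf.1, hconf.2.1, hconf.2.2⟩
  · right
    obtain ⟨h1, h2, h3⟩ := hconf
    have hee : P.epochOfSlot s = e + 1 := by
      have : P.epochOfSlot s ≠ e := fun hh => by
        rw [hh] at h1
        omega
      omega
    rw [hee] at h1 h2 h3
    subst h1
    exact ⟨rfl, hg, hview, h2, h3, hslot⟩

namespace Assumptions

variable {β d : ℝ} {W : ℝ≥0∞} (hA : X.Assumptions β d W) {v : V} (hv : v ∈ X.honest)

include hA hv

/-- A block found confirmed at the start of an epoch is canonical during that epoch. -/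
theorem anc_forkChoice_of_confirmedAtEpochStart {b : B} {e : ℕ}
    (h : X.ConfirmedAtEpochStart β W v b e) {t : Time} (ht : P.epochAt t = e + 1) {v' : V}
    (hv' : v' ∈ X.honest) : P.Anc b (X.forkChoice v' t) := by
  induction hn : P.slotAt t using Nat.strong_induction_on generalizing t v' with
  | _ n ih =>
    obtain ⟨b', hb'v, hb, he, hJ, hsafe⟩ := h.witness
    have hvs : P.votingSource b' (e + 1) = P.gu b' := if_pos he
    rw [hvs] at hJ hsafe
    obtain ⟨ht1, ht2⟩ := epochAt_eq_iff.mp ht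
    have hg : X.ggst ≤ P.epochStart (e + 1) := h.ggst_le.trans (epochStart_mono (Nat.le_succ e))
    have hstart : P.epochStart (e + 1) ≤ t := epochStart_le_iff.mpr ht.ge
    -- The rule looks for `b'` one slot before the epoch boundary, so that gossip brings it to all
    -- honest validators by the boundary.
    have hb'v' : b' ∈ blocksOf (X.view v' t) := by
      have hpos : P.firstSlot (e + 1) - 1 + 1 = P.firstSlot (e + 1) := by
        rw [← lastSlot_add_one, Nat.add_sub_cancel]
      have := (hA.run.slotStart_add_Δ_lt hv (P.firstSlot (e + 1) - 1)).le
      rw [hpos] at this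
      exact hA.run.mem_view_of_mem_view hv' hv hb'v (this.trans hstart) (hg.trans hstart)
    obtain ⟨hG, hJG, -⟩ := hA.gjAt_comparable hv' ht hb hb'v' he (by omega) (h.chkpVoted hA hv)
      (h.slot_le _ ⟨b', (hA.gasper.gu_spec b').1⟩)
    refine hA.anc_forkChoice hv hg hsafe hv' ht1 (fun i hi k hk1 hk2 => ?_) hJG
      fun a ha => hA.keptByHFC hv' hG hb'v' hb ?_ (fun x hx hxs => ?_) ha
    · have hks := hA.run.voteTime_slot i hi k
      refine ih k (hn ▸ hk2) (epochAt_eq_iff.mpr ?_) hi hks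
      rw [hks]
      exact ⟨hk1, hk2.trans ht2⟩
    · have := epoch_lt_iff.mp he
      omega
    · have hxe := epoch_le_epochAt hxs
      rw [ht] at hxe ⊢
      have := hA.gasper.gu_epoch_le_votingSource hx he hxe
      omega

theorem exists_confirmedAtEpochStart_succ {b : B} {e : ℕ}
    (h : X.ConfirmedAtEpochStart β W v b e) :
    ∃ c, P.Anc b c ∧ X.ConfirmedAtEpochStart β W v c (e + 1) :=
  hA.exists_confirmedAtEpochStart hv h.epoch_le
    (h.ggst_le.trans (epochStart_mono (Nat.le_succ e))) (h.chkpVoted hA hv)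
    fun _ ht _ hi => hA.anc_forkChoice_of_confirmedAtEpochStart hv h ht hi

theorem exists_confirmedAtEpochStart_of_le {b : B} {e n : ℕ}
    (h : X.ConfirmedAtEpochStart β W v b e) (hn : e ≤ n) :
    ∃ c, P.Anc b c ∧ X.ConfirmedAtEpochStart β W v c n := by
  induction n, hn using Nat.le_induction with
  | base => exact ⟨b, Anc.refl P b, h⟩
  | succ n _ ih =>
    obtain ⟨c, hbc, hc⟩ := ih
    obtain ⟨c', hcc', hc'⟩ := hA.exists_confirmedAtEpochStart_succ hv hc
    exact ⟨c', hbc.trans hcc', hc'⟩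

section InEpoch

variable {b : B} {s : ℕ} (h : X.ConfirmedInEpoch β W v b s)

include h

theorem exists_voter_of_confirmedInEpoch :
    ∃ i ∈ X.honest, ∃ k < s, P.Anc b (X.forkChoice i (X.voteTime i k)) := by
  refine hA.exists_voter_of_isLMDGHOSTSafe hv h.ggst_le_slotStart h.safe
    (Anc.refl P b) ?_
  rintro rfl
  have := h.source
  rw [epoch, P.slot_gen, epochOfSlot, Nat.zero_div] at this
  omega

theorem slot_lt_of_confirmedInEpoch : P.slot b < s := by
  obtain ⟨i, hi, k, hk, hb⟩ := hA.exists_voter_of_confirmedInEpoch hv h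
  exact (hA.run.slot_le_of_anc_voteTime hi hb).trans_lt hk

/-- Some honest validator voted for a descendant of `b` before slot `s`, so `b` has been gossiped.
-/
theorem mem_view_of_confirmedInEpoch {v' : V} (hv' : v' ∈ X.honest) {t : Time}
    (ht : s ≤ P.slotAt t) : b ∈ blocksOf (X.view v' t) := by
  obtain ⟨i, hi, k, hk, hb⟩ := hA.exists_voter_of_confirmedInEpoch hv h
  exact hA.run.mem_view_of_anc_forkChoice hv' hi hb (hk.trans_le ht)
    (h.ggst_le_slotStart.trans ((P.slotStart_le_iff _ _).mpr ht))

omit hv in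
theorem chkpAncBlock_gj_of_confirmedInEpoch : P.CanBeJustified (P.gj b) ∧
    P.ChkpAncBlock (P.gj b) b ∧ P.votingSource b (P.epoch b) = P.gj b := by
  have hvs : P.votingSource b (P.epoch b) = P.gj b := if_neg (lt_irrefl _)
  obtain ⟨x, h1, -, -, h4⟩ := votingSource_spec (P := P) (b := b) le_rfl
    (by have := h.source; omega)
  rw [hvs] at h4
  have hj := (hA.gasper.gu_spec x).1
  rw [← h4] at hj
  exact ⟨⟨x, hj⟩, hA.gasper.chkpAncBlock_of_justified hj h1, hvs⟩

/-- A block found confirmed in its own epoch is canonical during the rest of that epoch. -/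
theorem anc_forkChoice_of_confirmedInEpoch {t : Time} (hst : s ≤ P.slotAt t)
    (ht : P.epochAt t = P.epoch b) {v' : V} (hv' : v' ∈ X.honest) :
    P.Anc b (X.forkChoice v' t) := by
  induction hn : P.slotAt t using Nat.strong_induction_on generalizing t v' with
  | _ n ih =>
    obtain ⟨hgj, hgjb, hvs⟩ := hA.chkpAncBlock_gj_of_confirmedInEpoch h
    have hsrc := h.source
    have hslot := hA.slot_lt_of_confirmedInEpoch hv h
    have hbv := hA.mem_view_of_confirmedInEpoch hv h hv' hst
    obtain ⟨hG, hlt, hmax⟩ := hA.gjAt_spec hv' (t := t) (by omega)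
    have hge := hmax b hbv (by omega)
    rw [ht, hvs] at hge
    rw [ht] at hlt
    -- Within the epoch of `b`, no voting source is newer than the previous epoch, which `GJ(b)`
    -- already reaches; uniqueness does the rest.
    have heq : X.gjAt v' t = P.gj b := hA.justified_unique hG hgj (by omega)
    have hne : (P.gj b).block ≠ b := by
      intro hne
      have h1 := hgjb.slot_le
      rw [hne] at h1
      have h2 : P.firstSlot (P.epoch b) ≤ P.slot b := le_epoch_iff.mp le_rfl
      have h3 : P.firstSlot (P.gj b).epoch < P.firstSlot (P.epoch b) :=
        firstSlot_strictMono (by omega)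
      omega
    refine hA.anc_forkChoice hv h.ggst_le_slotStart h.safe hv' hst
      (fun i hi k hk1 hk2 => ?_) (heq ▸ Anc.refl P _) fun a ha =>
      hA.keptByHFC hv' (Or.inr (heq ▸ ⟨hgjb, hne⟩)) hbv (Anc.refl P b) (by omega)
        (fun x hx hxs => ?_) ha
    · have hks := hA.run.voteTime_slot i hi k
      refine ih k (hn ▸ hk2) (hks.symm ▸ hk1) (epochAt_eq_iff.mpr ?_) hi hks
      have h1 := (epochOfSlot_eq_iff.mp h.epoch_eq).1
      have h2 := (epochAt_eq_iff.mp ht).2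
      rw [hks]
      omega
    · have hxe := epoch_le_epochAt hxs
      have hxb := hx.epoch_le
      rw [ht] at hxe ⊢
      rw [votingSource_eq_of_anc hx rfl (le_antisymm hxe hxb) (by omega), hvs]
      omega

/-- The honest validators provide the FFG votes that are still missing. -/
theorem chkpVoted_of_confirmedInEpoch : X.ChkpVoted β W b (P.epoch b) := by
  have hj := h.justified
  have hg := h.ggst_le_slotStart
  have hsrc := h.source
  obtain ⟨hs1, hs2⟩ := epochOfSlot_eq_iff.mp h.epoch_eq
  simp only [willChkpBeJustified, slotAt_slotStart] at hj
  refine hj.trans ((add_le_add_right (hA.beta_bound hv hg _ _ _) _).trans ?_)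
  rw [← hA.weight_inter_honest (P.chkp b (P.epoch b)).block, ← weight_union]
  · refine weight_mono _ (Set.union_subset ?_ ?_)
    · rintro i ⟨hi, -⟩
      exact sent_mono (P.slotStart_strictMono.monotone hs2.le) (hA.run.view_subset_sent hv _ hi)
    -- An honest member of a remaining committee has a head above `b` in the same epoch, so its FFG
    -- vote has the same source and target as one for `b`.
    · rintro i ⟨⟨k, hk1, hk2, hk⟩, hi⟩
      have hks := hA.run.voteTime_slot i hi k
      have hke : P.epochOfSlot k = P.epoch b := epochOfSlot_eq_iff.mpr ⟨hs1.trans hk1, hk2⟩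
      have hvk := hA.run.votesIn_of_mem_committee hv hi hg
        (hg.trans (P.slotStart_strictMono.monotone hk1)) hk
      have hanc := hA.anc_forkChoice_of_confirmedInEpoch hv h (t := X.voteTime i k)
        (hks.symm ▸ hk1) (by rw [epochAt, hks, hke]) hi
      have hfe : P.epoch (X.forkChoice i (X.voteTime i k)) = P.epoch b := by
        refine le_antisymm ?_ hanc.epoch_le
        have := epoch_le_epochAt
          (hA.run.anc_forkChoice (t := X.voteTime i k) hi (Anc.refl P _)).1
        rwa [epochAt, hks, hke] at this
      have hcast := hA.run.casts_ffg i hi k hvk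
      rw [ffgVote, hke, votingSource_eq_of_anc hanc rfl hfe (by omega),
        chkp_eq_of_anc hanc (le_epoch_iff.mp le_rfl)] at hcast
      exact ⟨i, X.voteTime i k, le_self_add.trans (hA.run.voteTime_add_Δ_le hi hk2), hcast⟩
  · rw [Set.disjoint_left]
    rintro i ⟨-, k, hk1, hk2, hk⟩ ⟨⟨k', hk1', hk2', hk'⟩, -⟩
    have hdis := hA.run.committee_disjoint v hv (P.slotStart s) k k' (by omega)
      ((epochOfSlot_eq_iff.mpr ⟨hk1, hk2.trans hs2⟩).trans
        (epochOfSlot_eq_iff.mpr ⟨hs1.trans hk1', hk2'⟩).symm)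
    exact Finset.disjoint_left.mp hdis hk hk'

/-- A block found confirmed in its own epoch is canonical during the next epoch. -/
theorem anc_forkChoice_of_confirmedInEpoch_succ {t : Time} (ht : P.epochAt t = P.epoch b + 1)
    {v' : V} (hv' : v' ∈ X.honest) : P.Anc b (X.forkChoice v' t) := by
  induction hn : P.slotAt t using Nat.strong_induction_on generalizing t v' with
  | _ n ih =>
    obtain ⟨hgj, hgjb, hvs⟩ := hA.chkpAncBlock_gj_of_confirmedInEpoch h
    have hsrc := h.source
    have hslot := hA.slot_lt_of_confirmedInEpoch hv h
    obtain ⟨ht1, ht2⟩ := epochAt_eq_iff.mp ht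
    obtain ⟨hs1, hs2⟩ := epochOfSlot_eq_iff.mp h.epoch_eq
    have hst : s ≤ P.slotAt t := hs2.le.trans ht1
    have hbv := hA.mem_view_of_confirmedInEpoch hv h hv' hst
    have hguj : (P.gj b).epoch ≤ (P.gu b).epoch := by
      obtain ⟨x, h1, -, -, h4⟩ := votingSource_spec (P := P) (b := b) le_rfl (by omega)
      rw [← hvs, h4]
      exact hA.gasper.gu_epoch_mono h1
    obtain ⟨hG, -, hJG⟩ := hA.gjAt_comparable hv' ht (Anc.refl P b) hbv (Nat.lt_succ_self _)
      (by omega) (hA.chkpVoted_of_confirmedInEpoch hv h)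
      fun _ => (hA.gasper.chkpAncBlock_gu b).anc.slot_le
    -- Safety was tested with the balances of `GJ(b)`. The margin carries over because the fork
    -- choice now uses those of a descendant.
    have hgjG : P.Anc (P.gj b).block (X.gjAt v' t).block := by
      rcases hG with hG | ⟨hG, -⟩
      · exact hgjb.anc.trans hG
      · exact hG.anc_of_slot_le hgjb.anc
          (hgjb.slot_le.trans (firstSlot_mono (hguj.trans hJG)))
    refine hA.anc_forkChoice hv h.ggst_le_slotStart h.safe hv' hst
      (fun i hi k hk1 hk2 => ?_) hgjG fun a ha =>
      hA.keptByHFC hv' hG hbv (Anc.refl P b) (by omega) (fun x hx hxs => ?_) ha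
    · have hks := hA.run.voteTime_slot i hi k
      by_cases hkb : k < P.firstSlot (P.epoch b + 1)
      · refine hA.anc_forkChoice_of_confirmedInEpoch hv h (hks.symm ▸ hk1)
          (epochAt_eq_iff.mpr ?_) hi
        rw [hks]
        exact ⟨hs1.trans hk1, hkb⟩
      · refine ih k (hn ▸ hk2) (epochAt_eq_iff.mpr ?_) hi hks
        rw [hks]
        exact ⟨not_lt.mp hkb, hk2.trans ht2⟩
    · have hxe := epoch_le_epochAt hxs
      rw [ht] at hxe ⊢
      have := hA.gasper.gu_epoch_le_votingSource hx (Nat.lt_add_one _) hxe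
      omega

theorem exists_confirmedAtEpochStart_of_confirmedInEpoch :
    ∃ c, P.Anc b c ∧ X.ConfirmedAtEpochStart β W v c (P.epoch b + 1) :=
  hA.exists_confirmedAtEpochStart hv le_rfl
    (h.ggst_le.trans (epochStart_mono (Nat.le_succ _))) (hA.chkpVoted_of_confirmedInEpoch hv h)
    fun _ ht _ hi => hA.anc_forkChoice_of_confirmedInEpoch_succ hv h ht hi

end InEpoch

/-! ### Safety and monotonicity of the confirmation rule. -/

omit hv in
theorem slot_le_of_firstSlot_le {b : B} {e : ℕ} (hb : P.firstSlot e ≤ P.slot b)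
    (D : Checkpoint B) (hD : P.CanBeJustified D) (hDe : D.epoch + 1 = e) :
    P.slot D.block ≤ P.slot b :=
  (hA.gasper.slot_block_le hD).trans ((firstSlot_mono (by omega)).trans hb)

/-- A block found confirmed since the second slot of an epoch has descendants found confirmed at
the start of all later epochs. -/
theorem exists_confirmedAtEpochStart_of_confirmed {g : B} {e s : ℕ}
    (h : X.ConfirmedInEpoch β W v g s ∨
      s = P.firstSlot (e + 1) ∧ X.ConfirmedAtEpochStart β W v g e)
    (hs' : P.epochOfSlot s ≤ e + 1) {n : ℕ} (hn : P.epochOfSlot s + 1 ≤ n) :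
    ∃ c, P.Anc g c ∧ X.ConfirmedAtEpochStart β W v c n := by
  rcases h with h | ⟨rfl, h⟩
  · obtain ⟨c, hgc, hc⟩ := hA.exists_confirmedAtEpochStart_of_confirmedInEpoch hv h
    have := h.epoch_eq
    obtain ⟨c', hcc', hc'⟩ := hA.exists_confirmedAtEpochStart_of_le hv hc (n := n) (by omega)
    exact ⟨c', hgc.trans hcc', hc'⟩
  · rw [epochOfSlot_firstSlot] at hn
    exact hA.exists_confirmedAtEpochStart_of_le hv h (by omega)

theorem anc_forkChoice_of_confirmed {g : B} {e s : ℕ}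
    (h : X.ConfirmedInEpoch β W v g s ∨
      s = P.firstSlot (e + 1) ∧ X.ConfirmedAtEpochStart β W v g e)
    (hs' : P.epochOfSlot s ≤ e + 1) {v' : V} (hv' : v' ∈ X.honest) {t : Time}
    (ht : P.epochStart (e + 3) ≤ t) : P.Anc g (X.forkChoice v' t) := by
  -- Slot `s` may belong to epoch `e + 1`, so confirmed descendants are available for indices from
  -- `e + 2` on, and each is canonical in the epoch after its index.
  rw [epochStart_le_iff] at ht
  obtain ⟨c, hgc, hc⟩ := hA.exists_confirmedAtEpochStart_of_confirmed hv h hs'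
    (n := P.epochAt t - 1) (by omega)
  exact hgc.trans (hA.anc_forkChoice_of_confirmedAtEpochStart hv hc (by omega) hv')

/-- If some block not lower than the relevant justified checkpoints is found confirmed since the
second slot of the previous epoch, then it is confirmed. -/
theorem isConfirmed_of_mem {g : B} {e : ℕ} {t : Time} (hte : P.epochAt t = e + 1)
    (hg : X.ggst ≤ P.epochStart e) (hmem : g ∈ X.confirmedSinceEpoch β W v e t)
    (hslot : ∀ D : Checkpoint B, P.CanBeJustified D → D.epoch + 1 = e →
      P.slot D.block ≤ P.slot g) :
    X.isConfirmed β W v g t := by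
  have hfin : (X.confirmedSinceEpoch β W v e t).Finite := by
    refine (hA.run.blocksOf_view_finite hv t).subset ?_
    rintro b ⟨s, -, hs, hb, -⟩
    exact hA.run.view_mono v hv _ _ ((P.slotStart_le_iff _ _).mpr hs) hb
  have hex := Set.exists_max_image _ P.slot hfin ⟨g, hmem⟩
  rw [isConfirmed, hte, Nat.add_sub_cancel, highestConfirmedSinceEpoch, dif_pos hex]
  refine ⟨_, rfl, ?_⟩
  obtain ⟨hh, hmax⟩ := hex.choose_spec
  set h := hex.choose
  have hgh := hmax g hmem
  -- The slot condition passes from `g` to higher blocks, in particular to the highest confirmed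
  -- one. Both are then on the canonical chain of `v` at one time.
  have key : ∀ x ∈ X.confirmedSinceEpoch β W v e t, P.slot g ≤ P.slot x →
      P.Anc x (X.forkChoice v (P.epochStart (e + 3))) := by
    rintro x ⟨s, hs1, hs2, hx, hconf⟩ hgx
    have hs' : P.epochOfSlot s ≤ e + 1 := hte ▸ Nat.div_le_div_right hs2
    exact hA.anc_forkChoice_of_confirmed hv (confirmed_cases hg hs1 hs' hx hconf
      fun D hD hDe => (hslot D hD hDe).trans hgx) hs' hv le_rfl
  exact anc_of_slot_le (key g hmem le_rfl) (key h hh hgh) hgh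

omit hv in
theorem isConfirmationRule :
    X.IsConfirmationRule X.forkChoice (X.isConfirmed β W) (securityGuard P) := by
  rintro b t ⟨hbe, hg⟩ v hv ⟨h, hh, hbh⟩
  have hmem : h ∈ X.confirmedSinceEpoch β W v (P.epochAt t - 1) t := by
    rw [highestConfirmedSinceEpoch] at hh
    split_ifs at hh with hex
    · obtain rfl : hex.choose = h := Option.some.inj hh
      exact hex.choose_spec.1
    · cases hh
  obtain ⟨m, hm⟩ : ∃ m, P.epochAt t = m + 1 := by
    refine Nat.exists_eq_succ_of_ne_zero fun h0 => ?_
    obtain ⟨s, hs1, hs2, -⟩ := hmem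
    -- In epoch `0` the truncated subtraction makes the guard ask for `GGST` by the start of epoch
    -- `0`, but `GGST` is never before epoch `1`.
    have h1 : P.epochStart 1 ≤ X.ggst := by
      unfold ggst Protocol.ggst
      split_ifs <;> exact epochStart_mono (by omega)
    rw [h0] at hg
    exact absurd (h1.trans hg) (not_le.mpr (P.slotStart_strictMono
      (firstSlot_strictMono Nat.zero_lt_one)))
  rw [hm, Nat.add_sub_cancel] at hg hmem
  have hbslot : P.firstSlot m ≤ P.slot b := le_epoch_iff.mp (by omega)
  have hhslot := hbslot.trans hbh.slot_le
  have hD := hA.slot_le_of_firstSlot_le hhslot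
  obtain ⟨s, hs1, hs2, hview, hconf⟩ := id hmem
  have hs' : P.epochOfSlot s ≤ m + 1 := hm ▸ Nat.div_le_div_right hs2
  have hcases := confirmed_cases hg hs1 hs' hview hconf hD
  refine ⟨⟨P.epochStart (m + 3), fun v' hv' t' ht' =>
    hbh.trans (hA.anc_forkChoice_of_confirmed hv hcases hs' hv' ht')⟩, fun t' htt' => ?_⟩
  obtain ⟨n, hn⟩ : ∃ n, P.epochAt t' = n + 1 :=
    Nat.exists_eq_succ_of_ne_zero (by have := epochAt_mono (P := P) htt'; omega)
  have hmn : m ≤ n := by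
    have := epochAt_mono (P := P) htt'
    omega
  have hgn : X.ggst ≤ P.epochStart n := hg.trans (epochStart_mono hmn)
  suffices hex : ∃ g, P.Anc b g ∧ g ∈ X.confirmedSinceEpoch β W v n t' ∧
      ∀ D : Checkpoint B, P.CanBeJustified D → D.epoch + 1 = n → P.slot D.block ≤ P.slot g by
    obtain ⟨g, hbg, hg', hDg⟩ := hex
    obtain ⟨x, hx, hgx⟩ := hA.isConfirmed_of_mem hv hn hgn hg' hDg
    exact ⟨x, hx, hbg.trans hgx⟩
  have hst' : s ≤ P.slotAt t' := hs2.trans (slotAt_mono htt')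
  -- If the window of slots has not moved, `h` itself still counts. If `s` lies in an epoch before
  -- `n`, a descendant confirmed at the start of epoch `n + 1` takes over.
  rcases hmn.eq_or_lt with rfl | hlt
  · exact ⟨h, hbh, ⟨s, hs1, hst', hview, hconf⟩, hD⟩
  by_cases hsn : P.epochOfSlot s + 1 ≤ n
  · obtain ⟨c, hhc, hc⟩ := hA.exists_confirmedAtEpochStart_of_confirmed hv hcases hs' hsn
    exact ⟨c, hbh.trans hhc, ⟨P.firstSlot (n + 1), firstSlot_strictMono (Nat.lt_succ_self n),
      (epochAt_eq_iff.mp hn).1, hc.mem_view, hc.isConfirmedNoCaching⟩, hc.slot_le⟩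
  -- Now `s` lies in epoch `n`. A block confirmed in its own epoch has a slot before `s`, so `s` is
  -- not the first slot of the epoch and stays in the window. A confirmation at the first slot of
  -- epoch `n` just falls out of it, and the one at the start of epoch `n + 1` replaces it.
  · have hnm : n = m + 1 := by omega
    rcases hcases with hc | ⟨hsm, hc⟩
    · have heq := hc.epoch_eq
      have hslot : P.firstSlot n ≤ P.slot h := le_epoch_iff.mp (by omega)
      have hlt := hA.slot_lt_of_confirmedInEpoch hv hc
      exact ⟨h, hbh, ⟨s, by omega, hst', hview, hconf⟩, hA.slot_le_of_firstSlot_le hslot⟩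
    · obtain ⟨c, hhc, hc'⟩ := hA.exists_confirmedAtEpochStart_succ hv hc
      rw [← hnm] at hc'
      exact ⟨c, hbh.trans hhc, ⟨P.firstSlot (n + 1), firstSlot_strictMono (Nat.lt_succ_self n),
        (epochAt_eq_iff.mp hn).1, hc'.mem_view, hc'.isConfirmedNoCaching⟩, hc'.slot_le⟩

end Assumptions

end Execution

end Gasper

theorem mainTheorem2 {V B : Type*} (P : Gasper.Protocol V B) (X : Gasper.Execution P)
    (β safetyDecay : ℝ) (W : ENNReal)
    (hrun : X.FollowsProtocol)
    (hgasper : X.GasperProperties β safetyDecay)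
    (hfixed : X.FixedValidatorSet)
    (hbeta : X.BetaBound β)
    (hslash : X.SlashingBound W)
    (hstrong : X.StrongJustification β)
    (hlt : β < min (1 / 6) (1 / 3 - safetyDecay)) :
    X.IsConfirmationRule X.forkChoice (X.isConfirmed β W)
      (Gasper.Execution.securityGuard P) :=
  Gasper.Execution.Assumptions.isConfirmationRule
    ⟨hrun, hgasper, hfixed, hbeta, hslash, hstrong, lt_min_iff.mp hlt |>.1,
      lt_min_iff.mp hlt |>.2⟩
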